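/- **Setting.** Let $D\subset\mathbb R^d$ be open, $f\in L^2(D)$, and let $V=H^1_0(D)$ (the closure of $C_c^\infty(D)$ in $H^1(D)$) with $\|v\|_V=\|\nabla v\|_{L^2(D)}$. Let $Y_1,\dots,Y_N$ be independent real random variables such that the law of $Y_n$ has support $\Gamma_n=[\alpha_n,\beta_n]$, $\alpha_n<\beta_n$, and put $\Gamma=\prod_{n=1}^N\Gamma_n$. Let $a(y,x)=a_0(x)+\sum_{n=1}^N a_n(x)y_n$ with measurable $a_0,\dots,a_N:D\to\mathbb R$, and suppose there are constants $0<a_{\min}\le a_{\max}$ such that, for almost every value $y$ of $(Y_1,\dots,Y_N)$, $a_{\min}\le a(y,x)\le a_{\max}$ for all $x\in D$. Let $u:\Gamma\to V$ be the exact solution: for every $y\in\Gamma$, $\int_D a(y,x)\nabla u(y)\cdot\nabla v\,dx=\int_D f v\,dx$ for all $v\in V$. **Sparse grids.** Let $m(0)=0$, $m(1)=1$, $m(i)=2^{i-1}+1$ for $i>1$. Let $\mathcal U_n^{m}$ be Lagrange interpolation on $\Gamma_n$ at the $m$ Clenshaw–Curtis nodes of $\Gamma_n$, i.e. the images of $-\cos\frac{\pi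 (j-1)}{m-1}$, $j=1,\dots,m$ (the point $0$ if $m=1$) under the increasing affine map $[-1,1]\to\Gamma_n$; $\mathcal U_n^0=0$. For $i\in\{1,2,\dots\}^N$ let $\Delta^{m(i)}=\bigotimes_{n=1}^N(\mathcal U_n^{m(i_n)}-\mathcal U_n^{m(i_n-1)})$, and for a finite downward-closed set $I$ of such multi-indices let $S_I=\sum_{i\in I}\Delta^{m(i)}$. The margin $\mathcal M_I$ is the set of all $i\notin I$ with $i-e_n\in I$ for some $n$. The estimators are $$\zeta_{i,I}=\big\|\Delta^{m(i)}(a\nabla S_I[u])\big\|_{L^\infty(\Gamma,L^2(D))},\qquad \zeta_{SC,I}=\sum_{i\in\mathcal M_I}\zeta_{i,I}.$$ **Algorithm.** For $i\in\mathcal M_I$ let $A_{i,I}$ be the smallest subset of $\mathcal M_I$ containing $i$ such that $I\cup A_{i,I}$ is downward closed. The workless profit is $\mathcal P_{i,I}=\sum_{j\in A_{i,I}}\zeta_{j,I}$; the profit with work is $\mathcal P_{i,I}=\big(\sum_{j\in A_{i,I}}\zeta_{j,I}\big)/\big(\sum_{j\in A_{i,I}}W_j\big)$ with $W_j=\prod_{n=1}^N(m(j_n)-m(j_n-1))$.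 Start with $I_0=\{(1,\dots,1)\}$ and set $I_{\ell+1}=I_\ell\cup A_{i_\ell,I_\ell}$, where $i_\ell$ is the maximizer of $\mathcal P_{i,I_\ell}$ over $i\in\mathcal M_{I_\ell}$ that comes first in the lexicographic order (the loop is run without stopping test). **Theorem (Convergence of the parameter-enrichment algorithm).** For each of the two profits, $$\lim_{\ell\to\infty}\zeta_{SC,I_\ell}=0\qquad\text{and}\qquad\lim_{\ell\to\infty}\|u-S_{I_\ell}[u]\|_{L^\infty(\Gamma,V)}=0 .$$ -/

import Mathlib

open MeasureTheory ProbabilityTheory Filter Topology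
open scoped ENNReal Gradient

noncomputable section

namespace SparseGrid

/-! ### Multi-index sets

Multi-indices are functions `Fin N → ℕ`. All index sets below are built from `{(1, …, 1)}`, hence
contain only multi-indices whose entries are all at least `1`. -/

/-- Multi-indices with `N` entries. -/
abbrev MIdx (N : ℕ) : Type := Fin N → ℕ

/-- `I` is downward closed: `i ∈ I` and `i_n > 1` imply `i - e_n ∈ I`. -/
def DownwardClosed {N : ℕ} (I : Finset (MIdx N)) : Prop :=
  ∀ i ∈ I, ∀ n : Fin N, 1 < i n → i - Pi.single n 1 ∈ I

/-- The margin of `I`: the multi-indices `i ∉ I` with `i - e_n ∈ I` for some `n`, that is, the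
`j + e_n ∉ I` with `j ∈ I`. -/
def margin {N : ℕ} (I : Finset (MIdx N)) : Finset (MIdx N) :=
  (I.biUnion fun j => Finset.univ.image fun n : Fin N => j + Pi.single n 1) \ I

open Classical in
/-- `A_{i,I}`: the smallest subset of the margin of `I` that contains `i` and whose union with `I`
is downward closed (the intersection of all such subsets). -/
def completion {N : ℕ} (I : Finset (MIdx N)) (i : MIdx N) : Finset (MIdx N) :=
  (margin I).filter fun k =>
    ∀ B : Finset (MIdx N), B ⊆ margin I → i ∈ B → DownwardClosed (I ∪ B) → k ∈ B

/-! ### Clenshaw–Curtis nodes and sparse grid interpolation -/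

/-- The doubling rule. -/
def doubling (i : ℕ) : ℕ :=
  if i = 0 then 0 else if i = 1 then 1 else 2 ^ (i - 1) + 1

/-- The `m` Clenshaw–Curtis nodes in `[-1, 1]`, indexed from `0`; for `m = 1` the node is `0`. -/
def ccNode (m : ℕ) (j : Fin m) : ℝ :=
  if m = 1 then 0 else -Real.cos (Real.pi * (j : ℝ) / ((m : ℝ) - 1))

/-- The `m` Clenshaw–Curtis nodes of the interval `[α, β]`. -/
def node (α β : ℝ) (m : ℕ) (j : Fin m) : ℝ :=
  (α + β) / 2 + (β - α) / 2 * ccNode m j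

/-- The value at `t` of the `j`-th Lagrange basis polynomial for the `m` nodes of `[α, β]`. -/
def lagrangeBasis (α β : ℝ) (m : ℕ) (j : Fin m) (t : ℝ) : ℝ :=
  (Lagrange.basis Finset.univ (node α β m) j).eval t

section Operators

variable {N : ℕ} {X : Type*} [AddCommGroup X] [Module ℝ X]

/-- Lagrange interpolation in the `n`-th variable at the `m` nodes of `[α_n, β_n]`, the other
variables being frozen; it is zero for `m = 0`. -/
def interp (α β : Fin N → ℝ) (n : Fin N) (m : ℕ) :
    Module.End ℝ ((Fin N → ℝ) → X) where
  toFun v y := ∑ j : Fin m, lagrangeBasis (α n) (β n) m j (y n) •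
    v (Function.update y n (node (α n) (β n) m j))
  map_add' v w := by
    funext y
    simp [smul_add, Finset.sum_add_distrib]
  map_smul' c v := by
    funext y
    simp [Finset.smul_sum, smul_comm c]

/-- The detail operator in the `n`-th variable at level `k`. -/
def detail (α β : Fin N → ℝ) (n : Fin N) (k : ℕ) : Module.End ℝ ((Fin N → ℝ) → X) :=
  interp α β n (doubling k) - interp α β n (doubling (k - 1))

/-- The hierarchical surplus, the tensor product over `n` of the detail operators at levels `i_n`:
the composition of the (commuting) detail operators in the individual variables. -/
def surplus (α β : Fin N → ℝ) (i : MIdx N) : Module.End ℝ ((Fin N → ℝ) → X) :=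
  (List.ofFn fun n : Fin N => (detail α β n (i n) : Module.End ℝ ((Fin N → ℝ) → X))).prod

/-- The sparse grid interpolant `S_I`. -/
def sparseInterp (α β : Fin N → ℝ) (I : Finset (MIdx N)) : Module.End ℝ ((Fin N → ℝ) → X) :=
  ∑ i ∈ I, surplus α β i

end Operators

/-! ### The adaptive enrichment loop, for given pointwise estimators -/

/-- The two profits that can drive the algorithm. -/
inductive ProfitKind
  | workless
  | withWork

/-- The work `W_j`. -/
def work {N : ℕ} (j : MIdx N) : ℕ :=
  ∏ n : Fin N, (doubling (j n) - doubling (j n - 1))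

/-- The profit of `i` with respect to `I`, where `ζ j` is the pointwise estimator of `j`. -/
def profit {N : ℕ} (kind : ProfitKind) (ζ : MIdx N → ℝ≥0∞) (I : Finset (MIdx N))
    (i : MIdx N) : ℝ≥0∞ :=
  match kind with
  | .workless => ∑ j ∈ completion I i, ζ j
  | .withWork => (∑ j ∈ completion I i, ζ j) / ((∑ j ∈ completion I i, work j : ℕ) : ℝ≥0∞)

open Classical in
/-- The multi-indices of the margin of `I` with maximal profit. -/
def maximizers {N : ℕ} (kind : ProfitKind) (ζ : MIdx N → ℝ≥0∞) (I : Finset (MIdx N)) :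
    Finset (MIdx N) :=
  (margin I).filter fun i => ∀ j ∈ margin I, profit kind ζ I j ≤ profit kind ζ I i

open Classical in
/-- The profit maximizer that comes first in the lexicographic order. (The default value `1` is
used only when the margin is empty, which happens only for `N = 0`.) -/
def selected {N : ℕ} (kind : ProfitKind) (ζ : MIdx N → ℝ≥0∞) (I : Finset (MIdx N)) : MIdx N :=
  if h : ((maximizers kind ζ I).image toLex).Nonempty then
    ofLex (((maximizers kind ζ I).image toLex).min' h)
  else 1

/-- The multi-index sets `I_ℓ` of the enrichment loop, run without stopping test, where `ζ I i` is
the pointwise estimator of `i` with respect to `I`. -/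
def enrich {N : ℕ} (kind : ProfitKind) (ζ : Finset (MIdx N) → MIdx N → ℝ≥0∞) :
    ℕ → Finset (MIdx N)
  | 0 => {1}
  | ℓ + 1 => enrich kind ζ ℓ ∪
      completion (enrich kind ζ ℓ) (selected kind (ζ (enrich kind ζ ℓ)) (enrich kind ζ ℓ))

/-! ### The function space and the diffusion problem -/

/-- The spatial Euclidean space. -/
abbrev Space (d : ℕ) : Type := EuclideanSpace ℝ (Fin d)

/-- Scalar functions in `L²(D)`. -/
abbrev L2 {d : ℕ} (D : Set (Space d)) : Type := Lp ℝ 2 (volume.restrict D)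

/-- Vector fields in `L²(D)`. -/
abbrev L2Field {d : ℕ} (D : Set (Space d)) : Type := Lp (Space d) 2 (volume.restrict D)

/-- The pairs `(φ, ∇φ)` of `L²` classes, for smooth `φ` with compact support in `D`. -/
def testGraph {d : ℕ} (D : Set (Space d)) : Set (L2 D × L2Field D) :=
  {p | ∃ φ : Space d → ℝ, ContDiff ℝ (⊤ : ℕ∞) φ ∧ HasCompactSupport φ ∧ tsupport φ ⊆ D ∧
    p.1 =ᵐ[volume.restrict D] φ ∧ p.2 =ᵐ[volume.restrict D] ∇ φ}

/-- The Sobolev space `H¹₀(D)`: the closure in `H¹` of the smooth functions with compact support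
in `D`. A function `v` is represented by the pair `(v, ∇v)` with its weak gradient `∇v`. (The
test functions already form a linear subspace, so that taking the span changes nothing.) -/
def H10 {d : ℕ} (D : Set (Space d)) : Submodule ℝ (L2 D × L2Field D) :=
  (Submodule.span ℝ (testGraph D)).topologicalClosure

/-- The `L²` function underlying an element of `H¹₀(D)`. -/
def val {d : ℕ} {D : Set (Space d)} (v : H10 D) : L2 D := v.1.1

/-- The weak gradient of an element of `H¹₀(D)`; the norm of `v` in `V = H¹₀(D)` is `‖grad v‖`. -/
def grad {d : ℕ} {D : Set (Space d)} (v : H10 D) : L2Field D := v.1.2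

/-- The affine diffusion coefficient `a(y, x) = a₀(x) + ∑ₙ aₙ(x) yₙ`. -/
def coeff {d N : ℕ} (a₀ : Space d → ℝ) (a : Fin N → Space d → ℝ) (y : Fin N → ℝ)
    (x : Space d) : ℝ :=
  a₀ x + ∑ n, a n x * y n

/-- `v` is the weak solution in `H¹₀(D)` of `-div (b ∇v) = f`. -/
def IsWeakSolution {d : ℕ} {D : Set (Space d)} (b : Space d → ℝ) (f : L2 D) (v : H10 D) : Prop :=
  ∀ w : H10 D, ∫ x in D, b x * inner ℝ (grad v x) (grad w x) = ∫ x in D, f x * val w x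

open Classical in
/-- The flux `b ∇v` in `L²(D)`. (It is square integrable whenever `b` is measurable and bounded on
`D`; otherwise the value `0` is used.) -/
def flux {d : ℕ} {D : Set (Space d)} (b : Space d → ℝ) (v : H10 D) : L2Field D :=
  if h : MemLp (fun x => b x • grad v x) 2 (volume.restrict D) then h.toLp else 0

/-- The parameter domain `Γ = ∏ₙ [αₙ, βₙ]`. -/
def paramBox {N : ℕ} (α β : Fin N → ℝ) : Set (Fin N → ℝ) := Set.Icc α β

section Estimators

variable {d N : ℕ} {D : Set (Space d)}

/-- The norm of `L^∞(Γ, L²(D))`. -/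
def normLinftyL2 (α β : Fin N → ℝ) (F : (Fin N → ℝ) → L2Field D) : ℝ≥0∞ :=
  eLpNorm F ∞ (volume.restrict (paramBox α β))

/-- The norm of `L^∞(Γ, V)`, where `V = H¹₀(D)` is normed by `‖v‖_V = ‖∇v‖` in `L²(D)`. -/
def normLinftyV (α β : Fin N → ℝ) (v : (Fin N → ℝ) → H10 D) : ℝ≥0∞ :=
  eLpNorm (fun y => grad (v y)) ∞ (volume.restrict (paramBox α β))

/-- The pointwise estimator `ζ_{i,I}`: the norm in `L^∞(Γ, L²(D))` of the hierarchical surplus of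
`a ∇ S_I[u]`. -/
def pointEstimator (a₀ : Space d → ℝ) (a : Fin N → Space d → ℝ) (α β : Fin N → ℝ)
    (u : (Fin N → ℝ) → H10 D) (I : Finset (MIdx N)) (i : MIdx N) : ℝ≥0∞ :=
  normLinftyL2 α β
    (surplus α β i fun y => flux (coeff a₀ a y) (sparseInterp α β I u y))

/-- The parametric estimator `ζ_{SC,I}`. -/
def paramEstimator (a₀ : Space d → ℝ) (a : Fin N → Space d → ℝ) (α β : Fin N → ℝ)
    (u : (Fin N → ℝ) → H10 D) (I : Finset (MIdx N)) : ℝ≥0∞ :=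
  ∑ i ∈ margin I, pointEstimator a₀ a α β u I i

/-- The multi-index sets `I_ℓ` chosen by the adaptive stochastic collocation algorithm. -/
def algorithmSets (kind : ProfitKind) (a₀ : Space d → ℝ) (a : Fin N → Space d → ℝ)
    (α β : Fin N → ℝ) (u : (Fin N → ℝ) → H10 D) : ℕ → Finset (MIdx N) :=
  enrich kind (pointEstimator a₀ a α β u)

end Estimators

end SparseGrid

end

open SparseGrid

noncomputable section

namespace SparseGrid

/-! ### Clenshaw–Curtis nodes and their Lagrange basis -/

/-! The plan is to bound every estimator `ζ_{i,I}` on a margin by a number `w i` that does not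
depend on `I`, with `w` summable. Convergence of the greedy loop then follows from domination alone;
no proof that the sets exhaust all multi-indices is needed.

Why a bound uniform in `I` exists: nestedness and polynomial exactness make the one-dimensional
details mutually annihilating idempotents, so the surpluses are too. The coefficient is affine in
`y`, and multiplication by `y_l` raises a polynomial degree by one, hence reaches at most the next
level in direction `l`. For `i` on the margin, the surplus of `a ∇S_I[u]` therefore only sees the
surpluses of `∇u` at the indices `i - e_l` lying in `I` (`surplus_affineMul_sparseInterp`).

Why the bound is summable (`exists_summable_bound`): `∇u` is the fixed point of a contraction affine
in `y`, so Picard iterates are polynomials converging geometrically (`exists_geometricApprox`).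
Lagrange basis functions at Clenshaw–Curtis nodes are bounded by 2 (`abs_lagrangeBasis_le`), so the
operator norms grow only like products of node counts, and geometric decay wins.

The loop (`tendsto_sum_margin_enrich`): the added sets are pairwise disjoint, so their `w`-masses
tend to zero. By maximality of the profit, each fixed margin index then has estimator tending to
zero, and dominated convergence over multi-indices gives the sum.

The error (`norm_sub_sparseInterp_le`): tested against gradients, the exact flux does not depend on
`y`, and interpolation reproduces constants. The Galerkin residual of `S_I[u]` is then exactly the
sum of the margin surpluses, and coercivity bounds the error by a multiple of the estimator. -/

/-- The modified Dirichlet kernel. -/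
def dirichlet (n : ℕ) (φ : ℝ) : ℝ :=
  ∑ k ∈ Finset.range n, (Real.cos (k * φ) + Real.cos ((k + 1 : ℕ) * φ))

/-- The closed form `sin (nφ) cot (φ/2)`, cleared of its denominator so that it also holds at
multiples of `2π`. -/
lemma dirichlet_mul_sin (n : ℕ) (φ : ℝ) :
    dirichlet n φ * Real.sin (φ / 2) = Real.sin (n * φ) * Real.cos (φ / 2) := by
  induction n with
  | zero => simp [dirichlet]
  | succ n ih =>
    have h1 : dirichlet (n + 1) φ = dirichlet n φ +
        (Real.cos (n * φ) + Real.cos ((n + 1 : ℕ) * φ)) := by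
      simp [dirichlet, Finset.sum_range_succ]
    have h2 : ((n + 1 : ℕ) : ℝ) * φ = n * φ + (φ / 2 + φ / 2) := by push_cast; ring
    rw [h1, add_mul, ih, h2]
    simp only [Real.cos_add, Real.sin_add]
    linear_combination (-(Real.sin (n * φ)) * Real.cos (φ / 2) - Real.cos (n * φ) * Real.sin (φ / 2)) * Real.sin_sq_add_cos_sq (φ / 2)

/-- In the closed form `sin (nφ) = sin (sπ)` vanishes, while `sin (φ/2)` vanishes only for `s` in
`2nℤ`. -/
lemma dirichlet_eq_zero {n : ℕ} (hn : n ≠ 0) {s : ℤ} (hs : ¬ (2 * n : ℤ) ∣ s) :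
    dirichlet n (Real.pi * s / n) = 0 := by
  have hn' : (n : ℝ) ≠ 0 := by exact_mod_cast hn
  have h := dirichlet_mul_sin n (Real.pi * s / n)
  have h1 : (n : ℝ) * (Real.pi * s / n) = s * Real.pi := by field_simp
  rw [h1, Real.sin_int_mul_pi, zero_mul] at h
  refine (mul_eq_zero.1 h).resolve_right fun h0 => hs ?_
  obtain ⟨k, hk⟩ := Real.sin_eq_zero_iff.1 h0
  refine ⟨k, ?_⟩
  have : (s : ℝ) = 2 * n * k := by
    field_simp at hk
    linarith
  exact_mod_cast this

lemma dirichlet_of_dvd {n : ℕ} (hn : n ≠ 0) {s : ℤ} (hs : (2 * n : ℤ) ∣ s) :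
    dirichlet n (Real.pi * s / n) = 2 * n := by
  have hn' : (n : ℝ) ≠ 0 := by exact_mod_cast hn
  obtain ⟨k, rfl⟩ := hs
  have h1 : Real.pi * ((2 * n * k : ℤ) : ℝ) / n = k * (2 * Real.pi) := by
    push_cast; field_simp
  have h2 (l : ℕ) : Real.cos (l * (k * (2 * Real.pi))) = 1 := by
    have := Real.cos_int_mul_two_pi (l * k)
    rw [← this]; push_cast; ring_nf
  simp only [dirichlet, h1, h2]
  simp; ring

open Polynomial in
/-- The unnormalised Lagrange basis polynomial at `cos θ` for the Chebyshev extrema. -/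
def chebBasis (n : ℕ) (θ : ℝ) : ℝ[X] :=
  ∑ k ∈ Finset.range n, (C (Real.cos (k * θ)) * Polynomial.Chebyshev.T ℝ (k : ℕ) +
    C (Real.cos ((k + 1 : ℕ) * θ)) * Polynomial.Chebyshev.T ℝ (k + 1 : ℕ))

/-- `T_k(cos φ) = cos kφ`, followed by the product-to-sum formula. -/
lemma chebBasis_eval_cos (n : ℕ) (θ φ : ℝ) :
    (chebBasis n θ).eval (Real.cos φ) = (dirichlet n (φ - θ) + dirichlet n (φ + θ)) / 2 := by
  simp only [chebBasis, dirichlet, Polynomial.eval_finsetSum, Polynomial.eval_add,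
    Polynomial.eval_mul, Polynomial.eval_C, Polynomial.Chebyshev.T_real_cos, ← Finset.sum_add_distrib, Finset.sum_div]
  refine Finset.sum_congr rfl fun k _ => ?_
  simp only [mul_sub, mul_add, Real.cos_add, Real.cos_sub, Int.cast_natCast]
  ring

lemma natDegree_chebBasis_le (n : ℕ) (θ : ℝ) : (chebBasis n θ).natDegree ≤ n := by
  refine Polynomial.natDegree_sum_le_of_forall_le _ _ fun k hk => ?_
  have hk := Finset.mem_range.1 hk
  refine (Polynomial.natDegree_add_le _ _).trans (max_le ?_ ?_) <;>
  refine (Polynomial.natDegree_C_mul_le _ _).trans ?_ <;>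
  rw [Polynomial.Chebyshev.natDegree_T] <;> omega

lemma abs_chebBasis_eval_le (n : ℕ) (θ : ℝ) {x : ℝ} (hx : |x| ≤ 1) :
    |(chebBasis n θ).eval x| ≤ 2 * n := by
  rw [chebBasis, Polynomial.eval_finsetSum]
  refine (Finset.abs_sum_le_sum_abs _ _).trans ?_
  refine (Finset.sum_le_card_nsmul _ _ 2 fun k _ => ?_).trans (by simp; linarith)
  rw [Polynomial.eval_add, Polynomial.eval_mul, Polynomial.eval_mul, Polynomial.eval_C,
    Polynomial.eval_C]
  refine (abs_add_le _ _).trans ?_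
  rw [abs_mul, abs_mul]
  have h (l : ℕ) (k : ℤ) : |Real.cos (l * θ)| * |(Polynomial.Chebyshev.T ℝ k).eval x| ≤ 1 :=
    mul_le_one₀ (Real.abs_cos_le_one _) (abs_nonneg _)
      (Polynomial.Chebyshev.abs_eval_T_real_le_one k hx)
  linarith [h k k, h (k + 1) ((k + 1 : ℕ))]

lemma ccNode_eq_cos {n : ℕ} (hn : n ≠ 0) (j : Fin (n + 1)) :
    ccNode (n + 1) j = Real.cos (Real.pi * ((n - j : ℤ) : ℝ) / n) := by
  have hn' : (n : ℝ) ≠ 0 := by exact_mod_cast hn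
  have h : Real.pi * ((n - j : ℤ) : ℝ) / n = Real.pi - Real.pi * (j : ℝ) / n := by
    push_cast; field_simp
  rw [h, Real.cos_pi_sub, ccNode, if_neg (by omega)]
  simp

lemma ccNode_mem (m : ℕ) (j : Fin m) : |ccNode m j| ≤ 1 := by
  unfold ccNode
  split_ifs
  · simp
  · rw [abs_neg]; exact Real.abs_cos_le_one _

/-- The two kernel arguments correspond to `s = j - i` and `s = 2n - i - j`; for distinct indices in
`[0, n]` neither is a multiple of `2n`. -/
lemma chebBasis_eval_ccNode_of_ne {n : ℕ} (hn : n ≠ 0) {i j : Fin (n + 1)} (hij : i ≠ j) :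
    (chebBasis n (Real.pi * ((n - j : ℤ) : ℝ) / n)).eval (ccNode (n + 1) i) = 0 := by
  have hij' : (i : ℕ) ≠ j := fun h => hij (Fin.ext h)
  have h1 : Real.pi * ((n - i : ℤ) : ℝ) / n - Real.pi * ((n - j : ℤ) : ℝ) / n =
      Real.pi * ((j - i : ℤ) : ℝ) / n := by push_cast; ring
  have h2 : Real.pi * ((n - i : ℤ) : ℝ) / n + Real.pi * ((n - j : ℤ) : ℝ) / n =
      Real.pi * ((2 * n - i - j : ℤ) : ℝ) / n := by push_cast; ring
  rw [ccNode_eq_cos hn, chebBasis_eval_cos, h1, h2, dirichlet_eq_zero hn, dirichlet_eq_zero hn]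
  · simp
  · intro h
    have := Int.eq_zero_of_abs_lt_dvd h (by rw [abs_lt]; omega)
    omega
  · intro h
    have := Int.eq_zero_of_abs_lt_dvd h (by rw [abs_lt]; omega)
    omega

/-- The difference of angles is zero and contributes `2n / 2`; the other kernel value is `0`, or
`2n` at an endpoint, so it can only help. -/
lemma le_chebBasis_eval_ccNode_self {n : ℕ} (hn : n ≠ 0) (j : Fin (n + 1)) :
    (n : ℝ) ≤ (chebBasis n (Real.pi * ((n - j : ℤ) : ℝ) / n)).eval (ccNode (n + 1) j) := by
  have h2 : Real.pi * ((n - j : ℤ) : ℝ) / n + Real.pi * ((n - j : ℤ) : ℝ) / n =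
      Real.pi * ((2 * (n - j) : ℤ) : ℝ) / n := by push_cast; ring
  have h0 : dirichlet n 0 = 2 * n := by
    simpa using dirichlet_of_dvd hn (s := 0) (by simp)
  rw [ccNode_eq_cos hn, chebBasis_eval_cos, h2, sub_self, h0]
  have : 0 ≤ dirichlet n (Real.pi * ((2 * (n - j) : ℤ) : ℝ) / n) := by
    by_cases h : (2 * n : ℤ) ∣ 2 * (n - j)
    · rw [dirichlet_of_dvd hn h]; positivity
    · rw [dirichlet_eq_zero hn h]
  linarith

lemma ccNode_injective (m : ℕ) : Function.Injective (ccNode m) := by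
  rcases m with _ | _ | n
  · intro i; exact i.elim0
  · intro i j _; exact Subsingleton.elim (α := Fin 1) _ _
  · intro i j h
    by_contra hij
    have h1 := chebBasis_eval_ccNode_of_ne (n := n + 1) (by omega) hij
    have h2 := le_chebBasis_eval_ccNode_self (n := n + 1) (by omega) j
    rw [h] at h1
    rw [h1] at h2
    push_cast at h2
    linarith [(Nat.cast_nonneg n : (0 : ℝ) ≤ n)]

lemma node_injective {α β : ℝ} (h : α < β) (m : ℕ) : Function.Injective (node α β m) := by
  intro i j hij
  unfold node at hij
  have h1 : (β - α) / 2 ≠ 0 := by linarith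
  exact ccNode_injective m (mul_left_cancel₀ h1 (add_left_cancel hij))

lemma node_mem {α β : ℝ} (h : α < β) (m : ℕ) (j : Fin m) : node α β m j ∈ Set.Icc α β := by
  have h1 := abs_le.1 (ccNode_mem m j)
  unfold node
  constructor <;> nlinarith

/-- By uniqueness of interpolation, the basis polynomial is `chebBasis`, transported to `[α, β]` and
divided by its value at its own node. The numerator is at most `2n` and that value at least `n`,
whence the constant 2. -/
lemma abs_lagrangeBasis_le {α β : ℝ} (h : α < β) (m : ℕ) (j : Fin m) {t : ℝ}
    (ht : t ∈ Set.Icc α β) : |lagrangeBasis α β m j t| ≤ 2 := by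
  rcases m with _ | _ | n
  · exact j.elim0
  · have : (Finset.univ : Finset (Fin (0 + 1))) = {j} := by
      ext x
      simp only [Finset.mem_univ, Finset.mem_singleton, true_iff]
      exact Subsingleton.elim (α := Fin 1) x j
    rw [lagrangeBasis, this, Lagrange.basis_singleton]
    simp
  · have hn : n + 1 ≠ 0 := by omega
    have hba : β - α ≠ 0 := by linarith
    set q := chebBasis (n + 1) (Real.pi * (((n + 1 : ℕ) - j : ℤ) : ℝ) / (n + 1 : ℕ)) with hq
    set A : Polynomial ℝ := Polynomial.C (2 / (β - α)) * Polynomial.X -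
      Polynomial.C ((α + β) / (β - α)) with hA
    have hself := le_chebBasis_eval_ccNode_self hn j
    rw [← hq] at hself
    set z := q.eval (ccNode (n + 1 + 1) j) with hz
    have hzpos : 0 < z := lt_of_lt_of_le (by positivity) hself
    have hAnode (i : Fin (n + 1 + 1)) : A.eval (node α β (n + 1 + 1) i) = ccNode (n + 1 + 1) i := by
      simp only [hA, node, Polynomial.eval_sub, Polynomial.eval_mul, Polynomial.eval_C,
        Polynomial.eval_X]
      field_simp
      ring
    have hdeg : A.natDegree ≤ 1 := by
      rw [hA]
      exact (Polynomial.natDegree_sub_le _ _).trans (max_le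
        ((Polynomial.natDegree_C_mul_le _ _).trans (by simp)) (by simp))
    have hinj : Set.InjOn (node α β (n + 1 + 1)) (Finset.univ : Finset (Fin (n + 1 + 1))) :=
      (node_injective h _).injOn
    have key : Lagrange.basis Finset.univ (node α β (n + 1 + 1)) j =
        Polynomial.C z⁻¹ * q.comp A := by
      refine Polynomial.eq_of_degrees_lt_of_eval_index_eq _ hinj ?_ ?_ ?_
      · rw [Lagrange.degree_basis hinj (Finset.mem_univ _)]
        simp
        exact_mod_cast Nat.lt_succ_self _
      · rw [Finset.card_univ, Fintype.card_fin]
        refine (Polynomial.degree_le_of_natDegree_le (n := n + 1) ?_).trans_lt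
          (by exact_mod_cast Nat.lt_succ_self _)
        refine (Polynomial.natDegree_C_mul_le _ _).trans ?_
        rw [Polynomial.natDegree_comp]
        exact (Nat.mul_le_mul (natDegree_chebBasis_le _ _) hdeg).trans (by simp)
      · intro i _
        rw [Polynomial.eval_mul, Polynomial.eval_C, Polynomial.eval_comp, hAnode]
        by_cases hij : i = j
        · subst hij
          rw [Lagrange.eval_basis_self hinj (Finset.mem_univ _), ← hz, inv_mul_cancel₀ hzpos.ne']
        · rw [Lagrange.eval_basis_of_ne (Ne.symm hij) (Finset.mem_univ _), hq,
            chebBasis_eval_ccNode_of_ne hn hij, mul_zero]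
    have hAt : |A.eval t| ≤ 1 := by
      have : A.eval t = (2 * t - (α + β)) / (β - α) := by
        simp only [hA, Polynomial.eval_sub, Polynomial.eval_mul, Polynomial.eval_C,
          Polynomial.eval_X]
        field_simp
      rw [this, abs_div, abs_of_pos (sub_pos.2 h), div_le_one (sub_pos.2 h), abs_le]
      constructor <;> linarith [ht.1, ht.2]
    rw [lagrangeBasis, key, Polynomial.eval_mul, Polynomial.eval_C, Polynomial.eval_comp, abs_mul,
      abs_inv, abs_of_pos hzpos, inv_mul_le_iff₀ hzpos]
    have := abs_chebBasis_eval_le (n + 1)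
      (Real.pi * (((n + 1 : ℕ) - j : ℤ) : ℝ) / (n + 1 : ℕ)) hAt
    rw [← hq] at this
    linarith

lemma doubling_zero : doubling 0 = 0 := rfl

lemma doubling_one : doubling 1 = 1 := rfl

lemma doubling_add_two (k : ℕ) : doubling (k + 2) = 2 ^ (k + 1) + 1 := by
  simp [doubling]

lemma doubling_strictMono : StrictMono doubling := by
  refine strictMono_nat_of_lt_succ fun k => ?_
  rcases k with _ | _ | k
  · simp [doubling]
  · simp [doubling]
  · rw [doubling_add_two, doubling_add_two]
    have := Nat.pow_lt_pow_right (a := 2) (by norm_num) (Nat.lt_succ_self (k + 1))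
    omega

/-- The Clenshaw–Curtis nodes for the doubling rule are nested. -/
lemma exists_node_eq (α β : ℝ) {a b : ℕ} (hab : a ≤ b) (j : Fin (doubling a)) :
    ∃ j' : Fin (doubling b), node α β (doubling b) j' = node α β (doubling a) j := by
  suffices h : ∃ j' : Fin (doubling b), ccNode (doubling b) j' = ccNode (doubling a) j by
    obtain ⟨j', h⟩ := h
    exact ⟨j', by simp only [node, h]⟩
  rcases hab.eq_or_lt with rfl | hab
  · exact ⟨j, rfl⟩
  rcases a with _ | _ | a
  · exact j.elim0
  -- The single node of level 1 is the midpoint, which has index `2 ^ c` among the `2 ^ (c + 1) + 1`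
  -- nodes.
  · obtain ⟨c, rfl⟩ : ∃ c, b = c + 2 := ⟨b - 2, by omega⟩
    have hlt : 2 ^ c < doubling (c + 2) := by
      rw [doubling_add_two, pow_succ]; have := Nat.one_le_two_pow (n := c); omega
    refine ⟨⟨2 ^ c, hlt⟩, ?_⟩
    have h1 : doubling (c + 2) ≠ 1 := by
      rw [doubling_add_two]; have := Nat.one_le_two_pow (n := c + 1); omega
    have h2 : doubling (0 + 1) = 1 := rfl
    unfold ccNode
    rw [if_neg h1, if_pos h2]
    have h3 : Real.pi * ((2 ^ c : ℕ) : ℝ) / ((doubling (c + 2) : ℝ) - 1) = Real.pi / 2 := by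
      rw [doubling_add_two]; push_cast; rw [pow_succ]; field_simp; ring
    rw [h3]; simp
  · obtain ⟨c, rfl⟩ : ∃ c, b = a + c + 2 := ⟨b - a - 2, by omega⟩
    have hj : (j : ℕ) < 2 ^ (a + 1) + 1 := j.2.trans_eq (doubling_add_two a)
    have hlt : (j : ℕ) * 2 ^ c < doubling (a + c + 2) := by
      refine lt_of_lt_of_eq ?_ (doubling_add_two (a + c)).symm
      rw [show a + c + 1 = (a + 1) + c by ring, pow_add]
      have : (j : ℕ) ≤ 2 ^ (a + 1) := by omega
      have := Nat.mul_le_mul_right (2 ^ c) this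
      omega
    refine ⟨⟨_, hlt⟩, ?_⟩
    have h1 (k : ℕ) : doubling (k + 2) ≠ 1 := by
      rw [doubling_add_two]; have := Nat.one_le_two_pow (n := k + 1); omega
    unfold ccNode
    have h2 (k : ℕ) : (doubling (k + 2) : ℝ) - 1 = 2 ^ (k + 1) := by
      rw [doubling_add_two]; push_cast; ring
    rw [if_neg (h1 _), if_neg (h1 _), h2, show (doubling (a + 1 + 1) : ℝ) - 1 = 2 ^ (a + 1) from h2 a]
    push_cast
    rw [show a + c + 1 = (a + 1) + c by ring, pow_add]
    have : (2 : ℝ) ^ c ≠ 0 := by positivity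
    congr 2
    field_simp

/-! ### Products of commuting operators -/

section ListProd

variable {ι M : Type*} [Monoid M]

lemma prod_map_eq_mul_of_mem [DecidableEq ι] {T : ι → M} (hT : ∀ a b, Commute (T a) (T b))
    {L : List ι} (hL : L.Nodup) {l : ι} (hl : l ∈ L) :
    (L.map T).prod = (L.map (Function.update T l 1)).prod * T l := by
  induction L with
  | nil => simp at hl
  | cons a L ih =>
    rw [List.nodup_cons] at hL
    by_cases hal : a = l
    · subst hal
      have h : L.map (Function.update T a 1) = L.map T := by
        refine List.map_congr_left fun b hb => Function.update_of_ne ?_ _ _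
        rintro rfl
        exact hL.1 hb
      have hc : Commute (T a) (L.map T).prod := by
        refine Commute.list_prod_right _ _ fun x hx => ?_
        obtain ⟨b, -, rfl⟩ := List.mem_map.1 hx
        exact hT a b
      simp [h, hc.eq]
    · have hl' : l ∈ L := (List.mem_cons.1 hl).resolve_left (Ne.symm hal)
      simp [ih hL.2 hl', Function.update_of_ne hal, mul_assoc]

lemma prod_map_idempotent {T : ι → M} (hT : ∀ a b, Commute (T a) (T b))
    (hi : ∀ a, T a * T a = T a) (L : List ι) : (L.map T).prod * (L.map T).prod = (L.map T).prod := by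
  induction L with
  | nil => simp
  | cons a L ih =>
    have hc : Commute (T a) (L.map T).prod := by
      refine Commute.list_prod_right _ _ fun x hx => ?_
      obtain ⟨b, -, rfl⟩ := List.mem_map.1 hx
      exact hT a b
    rw [List.map_cons, List.prod_cons, hc.symm.mul_mul_mul_comm, ih, hi]

end ListProd

/-! ### Algebra of the interpolation operators -/

section Operators

variable {N : ℕ} {X X' : Type*} [AddCommGroup X] [Module ℝ X] [AddCommGroup X'] [Module ℝ X']
  {α β : Fin N → ℝ}

/-- Multiplication by the `l`-th variable. -/
def mulVar (l : Fin N) : Module.End ℝ ((Fin N → ℝ) → X) where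
  toFun v y := y l • v y
  map_add' v w := by funext y; simp
  map_smul' c v := by funext y; simp [smul_comm c]

lemma mulVar_apply (l : Fin N) (v : (Fin N → ℝ) → X) (y : Fin N → ℝ) :
    mulVar l v y = y l • v y := rfl

lemma interp_apply (n : Fin N) (m : ℕ) (v : (Fin N → ℝ) → X) (y : Fin N → ℝ) :
    interp α β n m v y = ∑ j : Fin m, lagrangeBasis (α n) (β n) m j (y n) •
      v (Function.update y n (node (α n) (β n) m j)) := rfl

lemma detail_apply (n : Fin N) (k : ℕ) (v : (Fin N → ℝ) → X) (y : Fin N → ℝ) :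
    detail α β n k v y = interp α β n (doubling k) v y - interp α β n (doubling (k - 1)) v y := rfl

lemma interp_map (M : X →ₗ[ℝ] X') (n : Fin N) (m : ℕ) (v : (Fin N → ℝ) → X) :
    interp α β n m (fun y => M (v y)) = fun y => M (interp α β n m v y) := by
  funext y
  simp [interp_apply]

lemma detail_map (M : X →ₗ[ℝ] X') (n : Fin N) (k : ℕ) (v : (Fin N → ℝ) → X) :
    detail α β n k (fun y => M (v y)) = fun y => M (detail α β n k v y) := by
  funext y
  simp only [detail_apply, interp_map, map_sub]

lemma surplus_eq_prod_map (i : MIdx N) :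
    (surplus α β i : Module.End ℝ ((Fin N → ℝ) → X)) =
      ((List.finRange N).map fun n => (detail α β n (i n) : Module.End ℝ _)).prod := by
  rw [surplus, List.ofFn_eq_map]

lemma prod_map_detail_map (M : X →ₗ[ℝ] X') (i : MIdx N) (L : List (Fin N))
    (v : (Fin N → ℝ) → X) :
    (L.map fun n => (detail α β n (i n) : Module.End ℝ _)).prod (fun y => M (v y)) =
      fun y => M ((L.map fun n => (detail α β n (i n) : Module.End ℝ _)).prod v y) := by
  induction L with
  | nil => simp
  | cons a L ih => simp [ih, detail_map]

lemma surplus_map (M : X →ₗ[ℝ] X') (i : MIdx N) (v : (Fin N → ℝ) → X) :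
    surplus α β i (fun y => M (v y)) = fun y => M (surplus α β i v y) := by
  rw [surplus_eq_prod_map, surplus_eq_prod_map, prod_map_detail_map]

lemma sparseInterp_apply (I : Finset (MIdx N)) (v : (Fin N → ℝ) → X) (y : Fin N → ℝ) :
    sparseInterp α β I v y = ∑ i ∈ I, surplus α β i v y := by
  simp [sparseInterp]

lemma sparseInterp_map (M : X →ₗ[ℝ] X') (I : Finset (MIdx N)) (v : (Fin N → ℝ) → X) :
    sparseInterp α β I (fun y => M (v y)) = fun y => M (sparseInterp α β I v y) := by
  funext y
  simp only [sparseInterp_apply, surplus_map, map_sum]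

lemma interp_zero (n : Fin N) : (interp α β n 0 : Module.End ℝ ((Fin N → ℝ) → X)) = 0 := by
  ext v y
  simp [interp_apply]

lemma commute_interp {n n' : Fin N} (h : n ≠ n') (m m' : ℕ) :
    Commute (interp α β n m : Module.End ℝ ((Fin N → ℝ) → X)) (interp α β n' m') := by
  refine LinearMap.ext fun v => ?_
  funext y
  simp only [Module.End.mul_apply, interp_apply, Function.update_of_ne h,
    Function.update_of_ne h.symm, Finset.smul_sum]
  rw [Finset.sum_comm]
  refine Finset.sum_congr rfl fun j _ => Finset.sum_congr rfl fun k _ => ?_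
  rw [smul_comm, Function.update_comm h]

lemma commute_interp_mulVar {n l : Fin N} (h : n ≠ l) (m : ℕ) :
    Commute (interp α β n m : Module.End ℝ ((Fin N → ℝ) → X)) (mulVar l) := by
  refine LinearMap.ext fun v => ?_
  funext y
  simp only [Module.End.mul_apply, interp_apply, mulVar_apply, Function.update_of_ne h.symm,
    Finset.smul_sum]
  exact Finset.sum_congr rfl fun j _ => smul_comm _ _ _

lemma commute_detail_mulVar {n l : Fin N} (h : n ≠ l) (k : ℕ) :
    Commute (detail α β n k : Module.End ℝ ((Fin N → ℝ) → X)) (mulVar l) :=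
  (commute_interp_mulVar h _).sub_left (commute_interp_mulVar h _)

/-- `v` is a polynomial in the `n`-th variable with `k` coefficients. -/
def PolyIn (n : Fin N) (k : ℕ) (v : (Fin N → ℝ) → X) : Prop :=
  ∀ y, ∃ c : ℕ → X, ∀ t : ℝ, v (Function.update y n t) = ∑ s ∈ Finset.range k, t ^ s • c s

namespace PolyIn

variable {n : Fin N} {k : ℕ} {v w : (Fin N → ℝ) → X}

lemma mono (h : PolyIn n k v) {k' : ℕ} (hk : k ≤ k') : PolyIn n k' v := fun y => by
  obtain ⟨c, hc⟩ := h y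
  refine ⟨fun s => if s < k then c s else 0, fun t => ?_⟩
  rw [hc, ← Finset.sum_subset (Finset.range_subset_range.2 hk)]
  · exact Finset.sum_congr rfl fun s hs => by
      simp only [if_pos (Finset.mem_range.1 hs)]
  · intro s _ hs
    simp only [if_neg (Finset.mem_range.not.1 hs), smul_zero]

lemma zero (n : Fin N) (k : ℕ) : PolyIn n k (0 : (Fin N → ℝ) → X) := fun y => ⟨0, fun t => by simp⟩

lemma add (hv : PolyIn n k v) (hw : PolyIn n k w) : PolyIn n k (v + w) := fun y => by
  obtain ⟨c, hc⟩ := hv y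
  obtain ⟨d, hd⟩ := hw y
  exact ⟨c + d, fun t => by simp [hc, hd, Finset.sum_add_distrib]⟩

lemma sum {ι : Type*} (s : Finset ι) {v : ι → (Fin N → ℝ) → X} (h : ∀ i ∈ s, PolyIn n k (v i)) :
    PolyIn n k (∑ i ∈ s, v i) :=
  Finset.sum_induction _ _ (fun _ _ => add) (zero n k) h

lemma map (hv : PolyIn n k v) (M : X →ₗ[ℝ] X') : PolyIn n k fun y => M (v y) := fun y => by
  obtain ⟨c, hc⟩ := hv y
  exact ⟨fun s => M (c s), fun t => by simp [hc]⟩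

lemma const (n : Fin N) (x : X) : PolyIn n 1 (fun _ : Fin N → ℝ => x) := fun y =>
  ⟨fun _ => x, fun t => by simp⟩

lemma mulVar (hv : PolyIn n k v) (l : Fin N) : PolyIn n (k + 1) (mulVar l v) := by
  by_cases h : l = n
  · subst h
    intro y
    obtain ⟨c, hc⟩ := hv y
    refine ⟨fun s => c (s - 1) - if s = 0 then c 0 else 0, fun t => ?_⟩
    simp [Finset.sum_range_succ', mulVar_apply, hc, Finset.smul_sum, smul_smul, pow_succ']
  · refine PolyIn.mono (fun y => ?_) (Nat.le_succ k)
    obtain ⟨c, hc⟩ := hv y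
    refine ⟨fun s => y l • c s, fun t => ?_⟩
    rw [mulVar_apply, hc, Function.update_of_ne h, Finset.smul_sum]
    exact Finset.sum_congr rfl fun s _ => smul_comm _ _ _

end PolyIn

lemma polyIn_interp (hαβ : ∀ n, α n < β n) (n : Fin N) (m : ℕ) (v : (Fin N → ℝ) → X) :
    PolyIn n m (interp α β n m v) := fun y => by
  refine ⟨fun s => ∑ j : Fin m, (Lagrange.basis Finset.univ (node (α n) (β n) m) j).coeff s •
    v (Function.update y n (node (α n) (β n) m j)), fun t => ?_⟩
  simp only [interp_apply, Function.update_self, Function.update_idem, Finset.smul_sum]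
  rw [Finset.sum_comm]
  refine Finset.sum_congr rfl fun j _ => ?_
  have hdeg : (Lagrange.basis Finset.univ (node (α n) (β n) m) j).natDegree < m := by
    rw [Lagrange.natDegree_basis (node_injective (hαβ n) m).injOn (Finset.mem_univ _)]
    simp only [Finset.card_univ, Fintype.card_fin]
    have := j.2
    omega
  rw [lagrangeBasis, Polynomial.eval_eq_sum_range' hdeg, Finset.sum_smul]
  exact Finset.sum_congr rfl fun s _ => by rw [smul_smul, mul_comm]

lemma interp_eq_self (hαβ : ∀ n, α n < β n) {n : Fin N} {k m : ℕ} {v : (Fin N → ℝ) → X}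
    (hv : PolyIn n k v) (hkm : k ≤ m) : interp α β n m v = v := by
  funext y
  obtain ⟨c, hc⟩ := hv y
  have hy : v y = v (Function.update y n (y n)) := by rw [Function.update_eq_self]
  rw [interp_apply, hy, hc]
  simp only [hc, Finset.smul_sum]
  rw [Finset.sum_comm]
  refine Finset.sum_congr rfl fun s hs => ?_
  have hdeg : (Polynomial.X ^ s : Polynomial ℝ).degree < (Finset.univ : Finset (Fin m)).card := by
    rw [Polynomial.degree_X_pow, Finset.card_univ, Fintype.card_fin]
    exact_mod_cast (Finset.mem_range.1 hs).trans_le hkm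
  have h := congrArg (Polynomial.eval (y n))
    (Lagrange.eq_interpolate (node_injective (hαβ n) m).injOn hdeg)
  rw [Lagrange.interpolate_apply, Polynomial.eval_finsetSum] at h
  simp only [Polynomial.eval_pow, Polynomial.eval_X, Polynomial.eval_mul, Polynomial.eval_C] at h
  rw [h, Finset.sum_smul]
  exact Finset.sum_congr rfl fun j _ => by rw [smul_smul, lagrangeBasis, mul_comm]

lemma interp_update_node (hαβ : ∀ n, α n < β n) (n : Fin N) (m : ℕ) (j : Fin m)
    (v : (Fin N → ℝ) → X) (y : Fin N → ℝ) :
    interp α β n m v (Function.update y n (node (α n) (β n) m j)) =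
      v (Function.update y n (node (α n) (β n) m j)) := by
  have hinj := (node_injective (hαβ n) m).injOn (s := ((Finset.univ : Finset (Fin m)) : Set _))
  simp only [interp_apply, Function.update_self, Function.update_idem]
  rw [Finset.sum_eq_single j]
  · rw [lagrangeBasis, Lagrange.eval_basis_self hinj (Finset.mem_univ _), one_smul]
  · intro i _ hij
    rw [lagrangeBasis, Lagrange.eval_basis_of_ne hij (Finset.mem_univ _), zero_smul]
  · simp

/-- Nestedness: coarse nodes are fine nodes, where the fine interpolant keeps the values of the
function. With the polynomial exactness of `interp_mul_interp_of_ge`, the product of two levels is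
always the coarser one. -/
lemma interp_mul_interp_of_le (hαβ : ∀ n, α n < β n) (n : Fin N) {a b : ℕ} (hab : a ≤ b) :
    (interp α β n (doubling a) * interp α β n (doubling b) : Module.End ℝ ((Fin N → ℝ) → X)) =
      interp α β n (doubling a) := by
  refine LinearMap.ext fun v => ?_
  funext y
  rw [Module.End.mul_apply, interp_apply, interp_apply]
  refine Finset.sum_congr rfl fun j _ => ?_
  obtain ⟨j', hj'⟩ := exists_node_eq (α n) (β n) hab j
  rw [← hj', interp_update_node hαβ]

lemma interp_mul_interp_of_ge (hαβ : ∀ n, α n < β n) (n : Fin N) {a b : ℕ} (hab : b ≤ a) :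
    (interp α β n (doubling a) * interp α β n (doubling b) : Module.End ℝ ((Fin N → ℝ) → X)) =
      interp α β n (doubling b) :=
  LinearMap.ext fun v => interp_eq_self hαβ (polyIn_interp hαβ n _ v)
    (doubling_strictMono.monotone hab)

lemma detail_mul_self (hαβ : ∀ n, α n < β n) (n : Fin N) (k : ℕ) :
    (detail α β n k * detail α β n k : Module.End ℝ ((Fin N → ℝ) → X)) = detail α β n k := by
  simp only [detail, mul_sub, sub_mul]
  rw [interp_mul_interp_of_le hαβ n le_rfl, interp_mul_interp_of_le hαβ n le_rfl,
    interp_mul_interp_of_le hαβ n (Nat.sub_le k 1), interp_mul_interp_of_ge hαβ n (Nat.sub_le k 1)]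
  abel

lemma detail_mul_of_ne (hαβ : ∀ n, α n < β n) (n : Fin N) {a b : ℕ} (hab : a ≠ b) :
    (detail α β n a * detail α β n b : Module.End ℝ ((Fin N → ℝ) → X)) = 0 := by
  simp only [detail, mul_sub, sub_mul]
  rcases hab.lt_or_gt with h | h
  · rw [interp_mul_interp_of_le hαβ n (show a ≤ b by omega),
      interp_mul_interp_of_le hαβ n (show a - 1 ≤ b by omega),
      interp_mul_interp_of_le hαβ n (show a ≤ b - 1 by omega),
      interp_mul_interp_of_le hαβ n (show a - 1 ≤ b - 1 by omega)]
    abel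
  · rw [interp_mul_interp_of_ge hαβ n (show b ≤ a by omega),
      interp_mul_interp_of_ge hαβ n (show b ≤ a - 1 by omega),
      interp_mul_interp_of_ge hαβ n (show b - 1 ≤ a by omega),
      interp_mul_interp_of_ge hαβ n (show b - 1 ≤ a - 1 by omega)]
    abel

lemma commute_detail (hαβ : ∀ n, α n < β n) (n n' : Fin N) (k k' : ℕ) :
    Commute (detail α β n k : Module.End ℝ ((Fin N → ℝ) → X)) (detail α β n' k') := by
  by_cases h : n = n'
  · subst h
    by_cases hk : k = k'
    · subst hk; exact Commute.refl _
    · rw [Commute, SemiconjBy, detail_mul_of_ne hαβ n hk, detail_mul_of_ne hαβ n (Ne.symm hk)]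
  · exact ((commute_interp h _ _).sub_left (commute_interp h _ _)).sub_right
      ((commute_interp h _ _).sub_left (commute_interp h _ _))

lemma detail_eq_zero (hαβ : ∀ n, α n < β n) {n : Fin N} {k m : ℕ} {v : (Fin N → ℝ) → X}
    (hv : PolyIn n m v) (hm : m ≤ doubling (k - 1)) : detail α β n k v = 0 := by
  rw [detail, LinearMap.sub_apply, interp_eq_self hαβ hv hm, interp_eq_self hαβ hv
    (hm.trans (doubling_strictMono.monotone (Nat.sub_le k 1))), sub_self]

lemma polyIn_detail (hαβ : ∀ n, α n < β n) (n : Fin N) (k : ℕ) (v : (Fin N → ℝ) → X) :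
    PolyIn n (doubling k) (detail α β n k v) := by
  have h := ((polyIn_interp hαβ n (doubling (k - 1)) v).mono
    (doubling_strictMono.monotone (Nat.sub_le k 1))).map (-LinearMap.id)
  convert (polyIn_interp hαβ n (doubling k) v).add h using 1
  funext y
  simp [detail_apply, sub_eq_add_neg]

lemma sum_detail (n : Fin N) (k : ℕ) :
    ∑ s ∈ Finset.Icc 1 k, (detail α β n s : Module.End ℝ ((Fin N → ℝ) → X)) =
      interp α β n (doubling k) := by
  induction k with
  | zero => simp [doubling_zero, interp_zero]
  | succ k ih =>
    rw [Finset.sum_Icc_succ_top (by omega), ih, detail]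
    simp

/-- Interpolation sees only nodal values, and these do not change when a function is replaced by its
interpolant before multiplying. -/
lemma interp_mulVar_interp (hαβ : ∀ n, α n < β n) (n : Fin N) (m : ℕ) :
    (interp α β n m * (mulVar n * interp α β n m) : Module.End ℝ ((Fin N → ℝ) → X)) =
      interp α β n m * mulVar n := by
  refine LinearMap.ext fun v => ?_
  funext y
  rw [Module.End.mul_apply, Module.End.mul_apply, interp_apply, Module.End.mul_apply, interp_apply]
  refine Finset.sum_congr rfl fun j _ => ?_
  rw [mulVar_apply, mulVar_apply, interp_update_node hαβ]

lemma detail_mulVar_interp (hαβ : ∀ n, α n < β n) (n : Fin N) (k : ℕ) :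
    (detail α β n k * (mulVar n * interp α β n (doubling k)) :
      Module.End ℝ ((Fin N → ℝ) → X)) = detail α β n k * mulVar n := by
  have h1 := interp_mulVar_interp (X := X) hαβ n (doubling k)
  have h2 := interp_mul_interp_of_le (X := X) hαβ n (Nat.sub_le k 1)
  have h3 : (interp α β n (doubling (k - 1)) * (mulVar n * interp α β n (doubling k)) :
      Module.End ℝ ((Fin N → ℝ) → X)) = interp α β n (doubling (k - 1)) * mulVar n := by
    conv_lhs => rw [← h2]
    rw [mul_assoc, h1, ← mul_assoc, h2]
  rw [detail, sub_mul, sub_mul, h1, h3]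

/-! ### Algebra of the hierarchical surplus -/

/-- The product of the detail operators in all variables but the `l`-th. -/
def rest (α β : Fin N → ℝ) (i : MIdx N) (l : Fin N) : Module.End ℝ ((Fin N → ℝ) → X) :=
  ((List.finRange N).map (Function.update
    (fun n => (detail α β n (i n) : Module.End ℝ ((Fin N → ℝ) → X))) l 1)).prod

lemma surplus_eq_rest_mul (hαβ : ∀ n, α n < β n) (i : MIdx N) (l : Fin N) :
    (surplus α β i : Module.End ℝ ((Fin N → ℝ) → X)) = rest α β i l * detail α β l (i l) := by
  rw [surplus_eq_prod_map]
  exact prod_map_eq_mul_of_mem (fun a b => commute_detail hαβ a b _ _) (List.nodup_finRange N)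
    (List.mem_finRange l)

lemma commute_rest {i : MIdx N} {l : Fin N} {Q : Module.End ℝ ((Fin N → ℝ) → X)}
    (h : ∀ n, n ≠ l → Commute Q (detail α β n (i n))) : Commute Q (rest α β i l) := by
  refine Commute.list_prod_right _ _ fun x hx => ?_
  obtain ⟨n, -, rfl⟩ := List.mem_map.1 hx
  by_cases hn : n = l
  · subst hn
    simp
  · rw [Function.update_of_ne hn]
    exact h n hn

lemma surplus_eq_mul_rest (hαβ : ∀ n, α n < β n) (i : MIdx N) (l : Fin N) :
    (surplus α β i : Module.End ℝ ((Fin N → ℝ) → X)) = detail α β l (i l) * rest α β i l := by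
  rw [surplus_eq_rest_mul hαβ i l]
  exact (commute_rest fun n _ => commute_detail hαβ _ _ _ _).symm

lemma commute_mulVar_rest (i : MIdx N) (l : Fin N) :
    Commute (mulVar l : Module.End ℝ ((Fin N → ℝ) → X)) (rest α β i l) :=
  commute_rest fun _ hn => (commute_detail_mulVar hn _).symm

lemma rest_update (i : MIdx N) (l : Fin N) (s : ℕ) :
    (rest α β (Function.update i l s) l : Module.End ℝ ((Fin N → ℝ) → X)) = rest α β i l := by
  unfold rest
  congr 2
  funext n
  by_cases hn : n = l
  · subst hn; simp
  · simp [Function.update_of_ne hn]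

lemma surplus_update (hαβ : ∀ n, α n < β n) (i : MIdx N) (l : Fin N) (s : ℕ) :
    (surplus α β (Function.update i l s) : Module.End ℝ ((Fin N → ℝ) → X)) =
      rest α β i l * detail α β l s := by
  rw [surplus_eq_rest_mul hαβ _ l, rest_update, Function.update_self]

lemma surplus_mul_self (hαβ : ∀ n, α n < β n) (i : MIdx N) :
    (surplus α β i * surplus α β i : Module.End ℝ ((Fin N → ℝ) → X)) = surplus α β i := by
  rw [surplus_eq_prod_map]
  exact prod_map_idempotent (fun a b => commute_detail hαβ a b _ _)
    (fun a => detail_mul_self hαβ a _) _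

lemma surplus_mul_of_ne (hαβ : ∀ n, α n < β n) {i j : MIdx N} (hij : i ≠ j) :
    (surplus α β i * surplus α β j : Module.End ℝ ((Fin N → ℝ) → X)) = 0 := by
  obtain ⟨l, hl⟩ := Function.ne_iff.1 hij
  rw [surplus_eq_rest_mul hαβ i l, surplus_eq_mul_rest hαβ j l, mul_assoc, ← mul_assoc (detail _ _ _ _),
    detail_mul_of_ne hαβ l hl, zero_mul, mul_zero]

lemma surplus_eq_zero_of_polyIn (hαβ : ∀ n, α n < β n) {i : MIdx N} {l : Fin N} {m : ℕ}
    {v : (Fin N → ℝ) → X} (hv : PolyIn l m v) (hm : m ≤ doubling (i l - 1)) :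
    surplus α β i v = 0 := by
  rw [surplus_eq_rest_mul hαβ i l, Module.End.mul_apply, detail_eq_zero hαβ hv hm, map_zero]

lemma surplus_sparseInterp (hαβ : ∀ n, α n < β n) {I : Finset (MIdx N)} {i : MIdx N} (hi : i ∈ I)
    (v : (Fin N → ℝ) → X) : surplus α β i (sparseInterp α β I v) = surplus α β i v := by
  rw [sparseInterp, LinearMap.sum_apply, map_sum, Finset.sum_eq_single i]
  · rw [← Module.End.mul_apply, surplus_mul_self hαβ]
  · intro j _ hj
    rw [← Module.End.mul_apply, surplus_mul_of_ne hαβ hj.symm, LinearMap.zero_apply]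
  · exact fun h => absurd hi h

lemma sparseInterp_surplus (hαβ : ∀ n, α n < β n) {I : Finset (MIdx N)} {i : MIdx N} (hi : i ∈ I)
    (v : (Fin N → ℝ) → X) : sparseInterp α β I (surplus α β i v) = surplus α β i v := by
  rw [sparseInterp, LinearMap.sum_apply, Finset.sum_eq_single i]
  · rw [← Module.End.mul_apply, surplus_mul_self hαβ]
  · intro j _ hj
    rw [← Module.End.mul_apply, surplus_mul_of_ne hαβ hj, LinearMap.zero_apply]
  · exact fun h => absurd hi h

/-- The detail at level `i l` of `y_l v` depends on `v` only through its interpolant at that level,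
which telescopes into the details of levels `1, …, i l`. -/
lemma surplus_mulVar_eq_zero (hαβ : ∀ n, α n < β n) {i : MIdx N} {l : Fin N}
    {v : (Fin N → ℝ) → X}
    (h : ∀ s ∈ Finset.Icc 1 (i l), surplus α β (Function.update i l s) v = 0) :
    surplus α β i (mulVar l v) = 0 := by
  rw [surplus_eq_mul_rest hαβ i l, Module.End.mul_apply, ← Module.End.mul_apply (rest α β i l),
    ← (commute_mulVar_rest i l).eq, Module.End.mul_apply, ← Module.End.mul_apply,
    ← detail_mulVar_interp hαβ, Module.End.mul_apply, Module.End.mul_apply, ← sum_detail,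
    LinearMap.sum_apply, Finset.sum_eq_zero, map_zero, map_zero]
  intro s hs
  have := h s hs
  rwa [surplus_eq_mul_rest hαβ _ l, rest_update, Function.update_self] at this

/-- The surplus of `y_l` times another surplus vanishes unless the two indices are close. -/
lemma surplus_mulVar_surplus_eq_zero (hαβ : ∀ n, α n < β n) {i j : MIdx N} {l : Fin N}
    (h : (∃ n, n ≠ l ∧ i n ≠ j n) ∨ j l + 2 ≤ i l) (v : (Fin N → ℝ) → X) :
    surplus α β i (mulVar l (surplus α β j v)) = 0 := by
  rcases h with ⟨n, hnl, hn⟩ | h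
  -- A detail in a direction other than `l` passes through the multiplication by `y_l`, so two
  -- different levels meet and annihilate.
  · rw [surplus_eq_rest_mul hαβ i n, surplus_eq_mul_rest hαβ j n, Module.End.mul_apply,
      Module.End.mul_apply, ← Module.End.mul_apply (mulVar l),
      ← (commute_detail_mulVar hnl _).eq, Module.End.mul_apply,
      ← Module.End.mul_apply (detail _ _ _ _), detail_mul_of_ne hαβ n hn, LinearMap.zero_apply,
      map_zero]
  -- The product has `doubling (j l) + 1` coefficients in `y_l`. This is at most `doubling (j l +
  -- 1)`, so the coarser interpolant in the detail at level `i l` is already exact.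
  · rw [surplus_eq_mul_rest hαβ j l, Module.End.mul_apply]
    refine surplus_eq_zero_of_polyIn hαβ ((polyIn_detail hαβ l (j l) _).mulVar l) ?_
    have h1 : doubling (j l) < doubling (i l - 1) := doubling_strictMono (by omega)
    omega

/-- `y_l` times a surplus is resolved by the surpluses up to the next level. -/
lemma sparseInterp_mulVar_surplus (hαβ : ∀ n, α n < β n) {J : Finset (MIdx N)} {j : MIdx N}
    {l : Fin N} (hJ : ∀ s ∈ Finset.Icc 1 (j l + 1), Function.update j l s ∈ J)
    (v : (Fin N → ℝ) → X) :
    sparseInterp α β J (mulVar l (surplus α β j v)) = mulVar l (surplus α β j v) := by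
  have h : mulVar l (surplus α β j v) = ∑ s ∈ Finset.Icc 1 (j l + 1),
      surplus α β (Function.update j l s) (mulVar l (detail α β l (j l) v)) := by
    rw [surplus_eq_rest_mul hαβ j l, ← Module.End.mul_apply, ← mul_assoc,
      (commute_mulVar_rest j l).eq, mul_assoc, Module.End.mul_apply, Module.End.mul_apply]
    conv_lhs => rw [← interp_eq_self hαβ ((polyIn_detail hαβ l (j l) v).mulVar l)
      (show doubling (j l) + 1 ≤ doubling (j l + 1) from doubling_strictMono (Nat.lt_succ_self _)),
      ← sum_detail, LinearMap.sum_apply, map_sum]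
    exact Finset.sum_congr rfl fun s _ => by rw [surplus_update hαβ, Module.End.mul_apply]
  rw [h, map_sum]
  exact Finset.sum_congr rfl fun s hs => sparseInterp_surplus hαβ (hJ s hs) _

lemma surplus_const_of_ne_one (hαβ : ∀ n, α n < β n) {i : MIdx N} (h : ∃ n, 2 ≤ i n) (x : X) :
    surplus α β i (fun _ => x) = 0 := by
  obtain ⟨n, hn⟩ := h
  refine surplus_eq_zero_of_polyIn hαβ (PolyIn.const n x) ?_
  have := doubling_strictMono.monotone (show 1 ≤ i n - 1 by omega)
  rwa [doubling_one] at this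

lemma surplus_one_const (hαβ : ∀ n, α n < β n) (x : X) :
    surplus α β (1 : MIdx N) (fun _ => x) = fun _ => x := by
  rw [surplus_eq_prod_map]
  induction List.finRange N with
  | nil => simp
  | cons a L ih =>
    rw [List.map_cons, List.prod_cons, Module.End.mul_apply, ih, Pi.one_apply, detail,
      LinearMap.sub_apply, interp_eq_self hαβ (PolyIn.const a x) (by rw [doubling_one])]
    simp [doubling_zero, interp_zero]

end Operators

/-! ### Norm bounds for interpolation and surpluses on the parameter box -/

section Bounds

variable {N : ℕ} {X : Type*} [NormedAddCommGroup X] [NormedSpace ℝ X] {α β : Fin N → ℝ}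

lemma norm_interp_le (hαβ : ∀ n, α n < β n) (n : Fin N) (m : ℕ) {v : (Fin N → ℝ) → X} {C : ℝ}
    (hv : ∀ y ∈ paramBox α β, ‖v y‖ ≤ C) {y : Fin N → ℝ} (hy : y ∈ paramBox α β) :
    ‖interp α β n m v y‖ ≤ 2 * m * C := by
  rw [interp_apply]
  have hC : 0 ≤ C := (norm_nonneg _).trans (hv y hy)
  refine (norm_sum_le _ _).trans ((Finset.sum_le_card_nsmul _ _ (2 * C) fun j _ => ?_).trans
    (by simp; linarith))
  rw [norm_smul, Real.norm_eq_abs]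
  refine mul_le_mul (abs_lagrangeBasis_le (hαβ n) m j ⟨hy.1 n, hy.2 n⟩) (hv _ ?_)
    (norm_nonneg _) (by norm_num)
  have hj := node_mem (hαβ n) m j
  constructor <;> intro k <;> by_cases hk : k = n
  · subst hk; simpa using hj.1
  · simpa [Function.update_of_ne hk] using hy.1 k
  · subst hk; simpa using hj.2
  · simpa [Function.update_of_ne hk] using hy.2 k

lemma norm_detail_le (hαβ : ∀ n, α n < β n) (n : Fin N) (k : ℕ) {v : (Fin N → ℝ) → X} {C : ℝ}
    (hv : ∀ y ∈ paramBox α β, ‖v y‖ ≤ C) {y : Fin N → ℝ} (hy : y ∈ paramBox α β) :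
    ‖detail α β n k v y‖ ≤ 4 * doubling k * C := by
  have hC : 0 ≤ C := (norm_nonneg _).trans (hv y hy)
  have h1 := norm_interp_le hαβ n (doubling k) hv hy
  have h2 := norm_interp_le hαβ n (doubling (k - 1)) hv hy
  have h3 : (doubling (k - 1) : ℝ) ≤ doubling k := by
    exact_mod_cast doubling_strictMono.monotone (Nat.sub_le k 1)
  have h4 := mul_le_mul_of_nonneg_right h3 hC
  rw [detail_apply]
  refine (norm_sub_le _ _).trans ?_
  linarith

/-- The bound for the norm of the hierarchical surplus. -/
def surplusBound (i : MIdx N) : ℝ := ∏ n, (4 * doubling (i n) : ℝ)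

lemma surplusBound_nonneg (i : MIdx N) : 0 ≤ surplusBound i :=
  Finset.prod_nonneg fun _ _ => by positivity

lemma norm_surplus_le (hαβ : ∀ n, α n < β n) (i : MIdx N) {v : (Fin N → ℝ) → X} {C : ℝ}
    (hv : ∀ y ∈ paramBox α β, ‖v y‖ ≤ C) {y : Fin N → ℝ} (hy : y ∈ paramBox α β) :
    ‖surplus α β i v y‖ ≤ surplusBound i * C := by
  have hC : 0 ≤ C := (norm_nonneg _).trans (hv y hy)
  rw [surplusBound, ← List.prod_ofFn, List.ofFn_eq_map, surplus_eq_prod_map]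
  induction List.finRange N generalizing y with
  | nil => simpa using hv y hy
  | cons a L ih =>
    rw [List.map_cons, List.prod_cons, Module.End.mul_apply, List.map_cons, List.prod_cons,
      mul_assoc]
    exact norm_detail_le hαβ a (i a) (fun y hy => ih hy) hy

/-- All nodes lie in the box; the norm bound with `C = 0` expresses this. It matters because the
equation for `u` is known only on the box. -/
lemma surplus_congr (hαβ : ∀ n, α n < β n) (i : MIdx N) {v w : (Fin N → ℝ) → X}
    (h : ∀ y ∈ paramBox α β, v y = w y) {y : Fin N → ℝ} (hy : y ∈ paramBox α β) :
    surplus α β i v y = surplus α β i w y := by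
  have h1 := norm_surplus_le hαβ i (v := v - w) (C := 0) (fun y hy => by simp [h y hy]) hy
  rw [mul_zero, map_sub, Pi.sub_apply] at h1
  exact sub_eq_zero.1 (norm_le_zero_iff.1 h1)

end Bounds

/-! ### Margins, completions and the enrichment loop -/

section Loop

variable {N : ℕ} {I : Finset (MIdx N)} {i k : MIdx N}

lemma mem_margin : i ∈ margin I ↔ i ∉ I ∧ ∃ j ∈ I, ∃ n : Fin N, j + Pi.single n 1 = i := by
  simp only [margin, Finset.mem_sdiff, Finset.mem_biUnion, Finset.mem_image, Finset.mem_univ,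
    true_and]
  tauto

/-- The index sets produced by the enrichment loop: downward closed sets containing `(1, …, 1)`
with all entries at least `1`. -/
structure IsIndexSet (I : Finset (MIdx N)) : Prop where
  downwardClosed : DownwardClosed I
  one_mem : 1 ∈ I
  one_le : ∀ i ∈ I, ∀ n, 1 ≤ i n

lemma IsIndexSet.one_le_of_mem_margin (hI : IsIndexSet I) (hi : i ∈ margin I) (n : Fin N) :
    1 ≤ i n := by
  obtain ⟨-, j, hj, n', rfl⟩ := mem_margin.1 hi
  exact (hI.one_le j hj n).trans (Nat.le_add_right _ _)

lemma DownwardClosed.sub_mem_of_mem_margin (hI : DownwardClosed I) (hk : k ∈ margin I) {n : Fin N}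
    (hn : 1 < k n) : k - Pi.single n 1 ∈ I ∨ k - Pi.single n 1 ∈ margin I := by
  obtain ⟨-, j, hj, n', rfl⟩ := mem_margin.1 hk
  by_cases hnn : n = n'
  · subst hnn
    left
    simpa using hj
  · have h1 : 1 < j n := by simpa [Pi.single_eq_of_ne hnn] using hn
    have h2 : j + Pi.single n' 1 - Pi.single n 1 = (j - Pi.single n 1) + Pi.single n' 1 := by
      funext m
      simp only [Pi.add_apply, Pi.sub_apply]
      by_cases hm : m = n
      · subst hm
        simp [Pi.single_eq_of_ne hnn]
      · simp [Pi.single_eq_of_ne hm]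
    by_cases h3 : j + Pi.single n' 1 - Pi.single n 1 ∈ I
    · exact Or.inl h3
    · exact Or.inr (mem_margin.2 ⟨h3, _, hI j hj n h1, n', h2.symm⟩)

lemma completion_subset_margin (I : Finset (MIdx N)) (i : MIdx N) : completion I i ⊆ margin I := by
  classical exact Finset.filter_subset _ _

lemma self_mem_completion (hi : i ∈ margin I) : i ∈ completion I i := by
  classical exact Finset.mem_filter.2 ⟨hi, fun _ _ h _ => h⟩

lemma DownwardClosed.union_completion (hI : DownwardClosed I) (i : MIdx N) :
    DownwardClosed (I ∪ completion I i) := by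
  classical
  intro k hk n hn
  rcases Finset.mem_union.1 hk with hk | hk
  · exact Finset.mem_union_left _ (hI k hk n hn)
  · obtain ⟨hkm, hkB⟩ := Finset.mem_filter.1 hk
    by_cases h : k - Pi.single n 1 ∈ I
    · exact Finset.mem_union_left _ h
    · refine Finset.mem_union_right _ (Finset.mem_filter.2
        ⟨(hI.sub_mem_of_mem_margin hkm hn).resolve_left h, fun B hB hiB hIB => ?_⟩)
      exact (Finset.mem_union.1 (hIB k (Finset.mem_union_right _ (hkB B hB hiB hIB)) n hn)).resolve_left h

/-- The margin indices below `i` form an admissible competitor in the intersection defining the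
completion. -/
lemma DownwardClosed.le_of_mem_completion (hI : DownwardClosed I) (hi : i ∈ margin I)
    (hk : k ∈ completion I i) : k ≤ i := by
  classical
  refine (Finset.mem_filter.1 ((Finset.mem_filter.1 hk).2 ((margin I).filter (· ≤ i))
    (Finset.filter_subset _ _) (Finset.mem_filter.2 ⟨hi, le_rfl⟩) ?_)).2
  intro j hj n hn
  rcases Finset.mem_union.1 hj with hj | hj
  · exact Finset.mem_union_left _ (hI j hj n hn)
  · obtain ⟨hjm, hji⟩ := Finset.mem_filter.1 hj
    rcases hI.sub_mem_of_mem_margin hjm hn with h | h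
    · exact Finset.mem_union_left _ h
    · exact Finset.mem_union_right _ (Finset.mem_filter.2 ⟨h, (tsub_le_self).trans hji⟩)

lemma IsIndexSet.union_completion (hI : IsIndexSet I) (i : MIdx N) :
    IsIndexSet (I ∪ completion I i) where
  downwardClosed := hI.downwardClosed.union_completion i
  one_mem := Finset.mem_union_left _ hI.one_mem
  one_le := fun _ hk n => (Finset.mem_union.1 hk).elim (fun hk => hI.one_le _ hk n)
    fun hk => hI.one_le_of_mem_margin (completion_subset_margin _ _ hk) n

lemma isIndexSet_enrich (kind : ProfitKind) (ζ : Finset (MIdx N) → MIdx N → ℝ≥0∞) (ℓ : ℕ) :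
    IsIndexSet (enrich kind ζ ℓ) := by
  induction ℓ with
  | zero =>
    refine ⟨fun i hi n hn => ?_, Finset.mem_singleton_self _, fun i hi n => ?_⟩
    · rw [Finset.mem_singleton.1 hi] at hn
      simp at hn
    · rw [Finset.mem_singleton.1 hi]
      simp
  | succ ℓ ih => exact ih.union_completion _

lemma selected_mem_maximizers (kind : ProfitKind) (ζ : MIdx N → ℝ≥0∞) (h : (margin I).Nonempty) :
    selected kind ζ I ∈ maximizers kind ζ I := by
  classical
  obtain ⟨i, hi, hmax⟩ := Finset.exists_max_image (margin I) (profit kind ζ I) h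
  have hne : ((maximizers kind ζ I).image toLex).Nonempty :=
    ⟨toLex i, Finset.mem_image_of_mem _ (Finset.mem_filter.2 ⟨hi, hmax⟩)⟩
  rw [selected, dif_pos hne]
  obtain ⟨j, hj, hj'⟩ := Finset.mem_image.1 (Finset.min'_mem _ hne)
  rw [← hj']
  exact hj

lemma one_le_work (hi : ∀ n, 1 ≤ i n) : 1 ≤ work i := by
  refine Finset.one_le_prod' fun n _ => ?_
  have := doubling_strictMono (show i n - 1 < i n by have := hi n; omega)
  omega

lemma profit_le {kind : ProfitKind} {ζ : MIdx N → ℝ≥0∞} (hI : IsIndexSet I) (hi : i ∈ margin I) :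
    profit kind ζ I i ≤ ∑ j ∈ completion I i, ζ j := by
  cases kind with
  | workless => exact le_rfl
  | withWork =>
    refine ENNReal.div_le_of_le_mul ?_
    have h1 : 1 ≤ ∑ j ∈ completion I i, work j :=
      (one_le_work (hI.one_le_of_mem_margin hi)).trans
        (Finset.single_le_sum (f := work) (fun _ _ => Nat.zero_le _) (self_mem_completion hi))
    exact le_mul_of_one_le_right' (by exact_mod_cast h1)

/-- The factor depends on `i` but not on `I`: the completion lies below `i`, which bounds its work.
The `+ 1` makes the factor at least one, as the workless profit requires. -/
lemma le_mul_profit {kind : ProfitKind} {ζ : MIdx N → ℝ≥0∞} (hI : IsIndexSet I)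
    (hi : i ∈ margin I) :
    ζ i ≤ ((∑ j ∈ Finset.Iic i, work j + 1 : ℕ) : ℝ≥0∞) * profit kind ζ I i := by
  have h0 : ζ i ≤ ∑ j ∈ completion I i, ζ j :=
    Finset.single_le_sum (f := ζ) (fun _ _ => zero_le) (self_mem_completion hi)
  cases kind with
  | workless => exact h0.trans (le_mul_of_one_le_left' (by exact_mod_cast Nat.le_add_left 1 _))
  | withWork =>
    have h1 : ∑ j ∈ completion I i, work j ≤ ∑ j ∈ Finset.Iic i, work j + 1 :=
      (Finset.sum_le_sum_of_subset fun k hk => Finset.mem_Iic.2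
        (hI.downwardClosed.le_of_mem_completion hi hk)).trans (Nat.le_succ _)
    have h2 : 1 ≤ ∑ j ∈ completion I i, work j :=
      (one_le_work (hI.one_le_of_mem_margin hi)).trans
        (Finset.single_le_sum (f := work) (fun _ _ => Nat.zero_le _) (self_mem_completion hi))
    have h3 : ((∑ j ∈ completion I i, work j : ℕ) : ℝ≥0∞) ≠ 0 := by
      exact_mod_cast (Nat.one_le_iff_ne_zero.1 h2)
    calc ζ i ≤ ∑ j ∈ completion I i, ζ j := h0
      _ = ((∑ j ∈ completion I i, work j : ℕ) : ℝ≥0∞) * profit .withWork ζ I i :=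
          (ENNReal.mul_div_cancel h3 (ENNReal.natCast_ne_top _)).symm
      _ ≤ _ := by gcongr

/-- The estimators of the margins tend to zero along the enrichment loop if they are dominated by
a summable family. -/
theorem tendsto_sum_margin_enrich (kind : ProfitKind) (ζ : Finset (MIdx N) → MIdx N → ℝ≥0∞)
    (w : MIdx N → ℝ≥0∞) (hw : ∑' i, w i ≠ ∞)
    (hζ : ∀ I, IsIndexSet I → ∀ i ∈ margin I, ζ I i ≤ w i) :
    Tendsto (fun ℓ => ∑ i ∈ margin (enrich kind ζ ℓ), ζ (enrich kind ζ ℓ) i) atTop (𝓝 0) := by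
  classical
  set J := enrich kind ζ with hJ
  set A : ℕ → Finset (MIdx N) := fun ℓ => completion (J ℓ) (selected kind (ζ (J ℓ)) (J ℓ)) with hA
  have hvalid (ℓ : ℕ) : IsIndexSet (J ℓ) := isIndexSet_enrich kind ζ ℓ
  -- Each added set is disjoint from the current index set, so every multi-index is charged at most
  -- once.
  have hsum (n : ℕ) : ∑ ℓ ∈ Finset.range n, ∑ j ∈ A ℓ, w j ≤ ∑ j ∈ J n, w j := by
    induction n with
    | zero => simp
    | succ n ih =>
      have hdisj : Disjoint (J n) (A n) := Finset.disjoint_left.2 fun i hi hiA =>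
        (mem_margin.1 (completion_subset_margin _ _ hiA)).1 hi
      rw [Finset.sum_range_succ, show J (n + 1) = J n ∪ A n from rfl,
        Finset.sum_union hdisj]
      gcongr
  have hAw : Tendsto (fun ℓ => ∑ j ∈ A ℓ, w j) atTop (𝓝 0) := by
    refine ENNReal.tendsto_atTop_zero_of_tsum_ne_top (ne_top_of_le_ne_top hw ?_)
    exact ENNReal.tsum_le_of_sum_range_le fun n => (hsum n).trans (ENNReal.sum_le_tsum _)
  -- The profit of `i` is at most that of the selected index, itself at most the `w`-mass of the set
  -- being added.
  have hbound (ℓ : ℕ) {i : MIdx N} (hi : i ∈ margin (J ℓ)) : ζ (J ℓ) i ≤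
      ((∑ j ∈ Finset.Iic i, work j + 1 : ℕ) : ℝ≥0∞) * ∑ j ∈ A ℓ, w j := by
    obtain ⟨hs, hmax⟩ := Finset.mem_filter.1
      (selected_mem_maximizers kind (ζ (J ℓ)) ⟨i, hi⟩)
    refine (le_mul_profit (kind := kind) (hvalid ℓ) hi).trans ?_
    gcongr
    refine (hmax i hi).trans ((profit_le (hvalid ℓ) hs).trans ?_)
    exact Finset.sum_le_sum fun j hj => hζ _ (hvalid ℓ) j (completion_subset_margin _ _ hj)
  -- Extension by zero off the margin turns the sums over varying margins into integrals for one
  -- counting measure, dominated by `w`.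
  set c : ℕ → MIdx N → ℝ≥0∞ := fun ℓ i => if i ∈ margin (J ℓ) then ζ (J ℓ) i else 0 with hc
  have hceq (ℓ : ℕ) : ∑ i ∈ margin (J ℓ), ζ (J ℓ) i = ∫⁻ i, c ℓ i ∂Measure.count := by
    rw [lintegral_count, tsum_eq_sum (s := margin (J ℓ)) fun i hi => if_neg hi]
    exact Finset.sum_congr rfl fun i hi => (if_pos hi).symm
  simp only [hceq]
  rw [← lintegral_zero (μ := (Measure.count : Measure (MIdx N)))]
  refine tendsto_lintegral_of_dominated_convergence w (fun _ => Measurable.of_discrete)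
    (fun ℓ => Eventually.of_forall fun i => ?_) (by rwa [lintegral_count])
    (Eventually.of_forall fun i => ?_)
  · simp only [hc]
    split_ifs with h
    · exact hζ _ (hvalid ℓ) i h
    · exact zero_le
  · refine tendsto_of_tendsto_of_tendsto_of_le_of_le tendsto_const_nhds
      (h := fun ℓ => ((∑ j ∈ Finset.Iic i, work j + 1 : ℕ) : ℝ≥0∞) * ∑ j ∈ A ℓ, w j) ?_
      (fun _ => zero_le) fun ℓ => ?_
    · simpa only [mul_zero] using ENNReal.Tendsto.const_mul hAw
        (Or.inr (ENNReal.natCast_ne_top (∑ j ∈ Finset.Iic i, work j + 1)))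
    · simp only [hc]
      split_ifs with h
      · exact hbound ℓ h
      · exact zero_le

end Loop

/-! ### Sparse grid interpolation and affine operators -/

lemma IsIndexSet.update_mem {N : ℕ} {I : Finset (MIdx N)} (hI : IsIndexSet I) {j : MIdx N}
    (hj : j ∈ I) {l : Fin N} {s : ℕ} (h1 : 1 ≤ s) (h2 : s ≤ j l) :
    Function.update j l s ∈ I := by
  induction h2 using Nat.decreasingInduction with
  | self => rwa [Function.update_eq_self]
  | of_succ k hk ih =>
    have h := hI.downwardClosed _ (ih (by omega)) l (by rw [Function.update_self]; omega)
    convert h using 1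
    funext n
    by_cases hn : n = l
    · subst hn; simp
    · simp [Function.update_of_ne hn, Pi.single_eq_of_ne hn]

section AffineMul

variable {N : ℕ} {E : Type*} [AddCommGroup E] [Module ℝ E] {α β : Fin N → ℝ}
  (M₀ : E →ₗ[ℝ] E) (M : Fin N → E →ₗ[ℝ] E)

/-- The operator `M₀ + ∑ₗ yₗ Mₗ` depending affinely on the parameter `y`. -/
def affineOp (y : Fin N → ℝ) : E →ₗ[ℝ] E := M₀ + ∑ l, y l • M l

/-- The pointwise action of an affine operator on a parametric function. -/
def affineMul (v : (Fin N → ℝ) → E) (y : Fin N → ℝ) : E := affineOp M₀ M y (v y)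

lemma affineMul_eq (v : (Fin N → ℝ) → E) :
    affineMul M₀ M v = (fun y => M₀ (v y)) + ∑ l, fun y => M l (mulVar l v y) := by
  funext y
  simp [affineMul, affineOp, mulVar_apply]

lemma affineMul_sub (v w : (Fin N → ℝ) → E) :
    affineMul M₀ M (v - w) = affineMul M₀ M v - affineMul M₀ M w := by
  funext y
  simp [affineMul]

lemma surplus_affineMul (i : MIdx N) (v : (Fin N → ℝ) → E) :
    surplus α β i (affineMul M₀ M v) =
      (fun y => M₀ (surplus α β i v y)) + ∑ l, fun y => M l (surplus α β i (mulVar l v) y) := by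
  simp only [affineMul_eq, map_add, map_sum, surplus_map]

lemma sparseInterp_affineMul (I : Finset (MIdx N)) (v : (Fin N → ℝ) → E) :
    sparseInterp α β I (affineMul M₀ M v) = (fun y => M₀ (sparseInterp α β I v y)) +
      ∑ l, fun y => M l (sparseInterp α β I (mulVar l v) y) := by
  simp only [affineMul_eq, map_add, map_sum, sparseInterp_map]

variable {I : Finset (MIdx N)} {M₀ M}

/-- A contributing `j` agrees with `i` off `l` and has `j l ≥ i l - 1`. If `j l ≥ i l`, downward
closedness would put `i` in `I`; only `j = i - e_l` remains. -/
lemma surplus_mulVar_sparseInterp (hαβ : ∀ n, α n < β n) (hI : IsIndexSet I) {i : MIdx N}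
    (hi : i ∈ margin I) (l : Fin N) (g : (Fin N → ℝ) → E) :
    surplus α β i (mulVar l (sparseInterp α β I g)) = if i - Pi.single l 1 ∈ I then
      surplus α β i (mulVar l (surplus α β (i - Pi.single l 1) g)) else 0 := by
  rw [sparseInterp, LinearMap.sum_apply, map_sum, map_sum]
  rw [← Finset.sum_ite_eq' I (i - Pi.single l 1)
    (fun j => surplus α β i (mulVar l (surplus α β j g)))]
  refine Finset.sum_congr rfl fun j hj => ?_
  split_ifs with h
  · rfl
  · refine surplus_mulVar_surplus_eq_zero hαβ ?_ g
    by_contra hcon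
    push Not at hcon
    obtain ⟨h1, h2⟩ := hcon
    have hil := hI.one_le_of_mem_margin hi l
    rcases Nat.lt_or_ge (j l) (i l) with h3 | h3
    · refine h (funext fun n => ?_)
      by_cases hn : n = l
      · subst hn; simp; omega
      · simp [Pi.single_eq_of_ne hn, h1 n hn]
    · refine (mem_margin.1 hi).1 ?_
      convert hI.update_mem hj hil h3 using 1
      funext n
      by_cases hn : n = l
      · subst hn; simp
      · rw [Function.update_of_ne hn, h1 n hn]

/-- On the margin only the finest surpluses contribute to the estimator. -/
lemma surplus_affineMul_sparseInterp (hαβ : ∀ n, α n < β n) (hI : IsIndexSet I) {i : MIdx N}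
    (hi : i ∈ margin I) (g : (Fin N → ℝ) → E) :
    surplus α β i (affineMul M₀ M (sparseInterp α β I g)) = ∑ l, fun y => M l
      ((if i - Pi.single l 1 ∈ I then
        surplus α β i (mulVar l (surplus α β (i - Pi.single l 1) g)) else 0) y) := by
  have h0 : surplus α β i (sparseInterp α β I g) = 0 := by
    rw [sparseInterp, LinearMap.sum_apply, map_sum]
    refine Finset.sum_eq_zero fun j hj => ?_
    rw [← Module.End.mul_apply, surplus_mul_of_ne hαβ, LinearMap.zero_apply]
    rintro rfl
    exact (mem_margin.1 hi).1 hj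
  rw [surplus_affineMul, h0]
  simp only [Pi.zero_apply, map_zero, surplus_mulVar_sparseInterp hαβ hI hi]
  exact zero_add _

/-- The interpolation error has no surplus on `I`. As `I` is downward closed,
`surplus_mulVar_eq_zero` preserves this under multiplication by each `y_l`. -/
lemma sparseInterp_affineMul_sparseInterp (hαβ : ∀ n, α n < β n) (hI : IsIndexSet I)
    (g : (Fin N → ℝ) → E) :
    sparseInterp α β I (affineMul M₀ M (sparseInterp α β I g)) =
      sparseInterp α β I (affineMul M₀ M g) := by
  have he {i : MIdx N} (hi : i ∈ I) : surplus α β i (sparseInterp α β I g - g) = 0 := by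
    rw [map_sub, surplus_sparseInterp hαβ hi, sub_self]
  rw [← sub_eq_zero, ← map_sub, ← affineMul_sub]
  generalize sparseInterp α β I g - g = e at he ⊢
  rw [sparseInterp, LinearMap.sum_apply]
  refine Finset.sum_eq_zero fun i hi => ?_
  have h1 (l : Fin N) : surplus α β i (mulVar l e) = 0 :=
    surplus_mulVar_eq_zero hαβ fun s hs => he
      (hI.update_mem hi (Finset.mem_Icc.1 hs).1 (Finset.mem_Icc.1 hs).2)
  rw [surplus_affineMul, he hi]
  simp only [h1, Pi.zero_apply, map_zero]
  funext y
  simp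

/-- Multiplication by `y_l` leads at most one level up in direction `l`, and one step out of `I`
lands in the margin. -/
lemma sparseInterp_union_margin (hαβ : ∀ n, α n < β n) (hI : IsIndexSet I)
    (g : (Fin N → ℝ) → E) :
    sparseInterp α β (I ∪ margin I) (affineMul M₀ M (sparseInterp α β I g)) =
      affineMul M₀ M (sparseInterp α β I g) := by
  have h0 : sparseInterp α β (I ∪ margin I) (sparseInterp α β I g) = sparseInterp α β I g := by
    conv_lhs => rw [sparseInterp.eq_def α β I, LinearMap.sum_apply, map_sum]
    rw [sparseInterp.eq_def α β I, LinearMap.sum_apply]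
    exact Finset.sum_congr rfl fun j hj => sparseInterp_surplus hαβ (Finset.mem_union_left _ hj) g
  have h1 (l : Fin N) : sparseInterp α β (I ∪ margin I) (mulVar l (sparseInterp α β I g)) =
      mulVar l (sparseInterp α β I g) := by
    rw [sparseInterp.eq_def α β I, LinearMap.sum_apply, map_sum, map_sum]
    refine Finset.sum_congr rfl fun j hj => sparseInterp_mulVar_surplus hαβ (fun s hs => ?_) g
    obtain ⟨hs1, hs2⟩ := Finset.mem_Icc.1 hs
    rcases Nat.lt_or_ge (j l) s with h | h
    · by_cases hmem : Function.update j l s ∈ I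
      · exact Finset.mem_union_left _ hmem
      · refine Finset.mem_union_right _ (mem_margin.2 ⟨hmem, j, hj, l, ?_⟩)
        funext n
        by_cases hn : n = l
        · subst hn; simp; omega
        · simp [Function.update_of_ne hn, Pi.single_eq_of_ne hn]
    · exact Finset.mem_union_left _ (hI.update_mem hj hs1 h)
  rw [sparseInterp_affineMul, h0]
  simp only [h1]
  rw [← affineMul_eq]

end AffineMul

/-! ### Reproduction of constants and the residual identity -/

section Estimates

variable {N : ℕ} {E : Type*} [NormedAddCommGroup E] [NormedSpace ℝ E] {α β : Fin N → ℝ}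
  {M₀ : E →ₗ[ℝ] E} {M : Fin N → E →ₗ[ℝ] E} {I : Finset (MIdx N)}

lemma sparseInterp_congr (hαβ : ∀ n, α n < β n) {v w : (Fin N → ℝ) → E}
    (h : ∀ y ∈ paramBox α β, v y = w y) {y : Fin N → ℝ} (hy : y ∈ paramBox α β) :
    sparseInterp α β I v y = sparseInterp α β I w y := by
  simp only [sparseInterp_apply]
  exact Finset.sum_congr rfl fun i _ => surplus_congr hαβ i h hy

lemma sparseInterp_const (hαβ : ∀ n, α n < β n) (hI : IsIndexSet I) (x : E) :
    sparseInterp α β I (fun _ => x) = fun _ => x := by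
  rw [sparseInterp, LinearMap.sum_apply, Finset.sum_eq_single 1, surplus_one_const hαβ]
  · intro i hi hne
    refine surplus_const_of_ne_one hαβ ?_ x
    obtain ⟨n, hn⟩ := Function.ne_iff.1 hne
    have := hI.one_le i hi n
    rw [Pi.one_apply] at hn
    exact ⟨n, by omega⟩
  · exact fun h => absurd hI.one_mem h

/-- The residual of the sparse grid interpolant, tested with a functional on which the exact flux
does not depend on the parameter, is given by the surpluses on the margin. -/
lemma residual_eq_sum_margin (hαβ : ∀ n, α n < β n) (hI : IsIndexSet I) {g : (Fin N → ℝ) → E}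
    (φ : E →ₗ[ℝ] ℝ) {c : ℝ} (hφ : ∀ y ∈ paramBox α β, φ (affineMul M₀ M g y) = c)
    {y : Fin N → ℝ} (hy : y ∈ paramBox α β) :
    φ (affineMul M₀ M (sparseInterp α β I g) y) - c =
      φ (∑ i ∈ margin I, surplus α β i (affineMul M₀ M (sparseInterp α β I g)) y) := by
  -- `a S_I g` splits into `S_I(a S_I g) = S_I(a g)` plus the margin surpluses, and `φ` sends `S_I(a
  -- g)` to `S_I` of the constant `c`, which is `c`.
  have h1 := congrFun (sparseInterp_union_margin (M₀ := M₀) (M := M) hαβ hI g) y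
  have hd : Disjoint I (margin I) := Finset.disjoint_left.2 fun i hi him => (mem_margin.1 him).1 hi
  rw [sparseInterp_apply, Finset.sum_union hd, ← sparseInterp_apply,
    sparseInterp_affineMul_sparseInterp hαβ hI] at h1
  have h2 := congrFun (sparseInterp_map (α := α) (β := β) φ I (affineMul M₀ M g)) y
  rw [sparseInterp_congr hαβ (w := fun _ => c) hφ hy, sparseInterp_const hαβ hI] at h2
  rw [← h1, map_add, ← h2]
  ring

/-! ### Decay of the surpluses -/

lemma summable_pi_prod {f : ℕ → ℝ} (hf0 : ∀ k, 0 ≤ f k) (hf : Summable f) (N : ℕ) :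
    Summable fun i : Fin N → ℕ => ∏ n, f (i n) := by
  classical
  refine summable_of_sum_le (c := ∏ _n : Fin N, ∑' k, f k)
    (fun i => Finset.prod_nonneg fun n _ => hf0 _) fun s => ?_
  have hs : s ⊆ Fintype.piFinset fun n => s.image fun i => i n := fun i hi =>
    Fintype.mem_piFinset.2 fun n => Finset.mem_image_of_mem _ hi
  refine (Finset.sum_le_sum_of_subset_of_nonneg hs fun i _ _ =>
    Finset.prod_nonneg fun n _ => hf0 _).trans ?_
  rw [← Finset.prod_univ_sum (fun n => s.image fun i => i n) fun _ k => f k]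
  exact Finset.prod_le_prod (fun n _ => Finset.sum_nonneg fun k _ => hf0 k)
    fun n _ => hf.sum_le_tsum _ fun k _ => hf0 k

lemma doubling_add_two_le (k : ℕ) (hk : 1 ≤ k) : doubling (k + 2) ≤ 5 * doubling k := by
  rcases k with _ | _ | k
  · omega
  · simp [doubling]
  · rw [doubling_add_two, doubling_add_two, pow_add 2 (k + 1) 2]
    omega

/-- Up to the factor `400 = (4 * 5) ^ 2`, this is a subseries of `∑ m² r ^ m`, because `doubling` is
injective and two levels multiply it by at most 5. The shift by 3 removes the truncated subtraction.
-/
lemma summable_doubling_sq_mul_pow {r : ℝ} (hr0 : 0 ≤ r) (hr1 : r < 1) :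
    Summable fun k => (4 * doubling k : ℝ) ^ 2 * r ^ doubling (k - 2) := by
  have h : Summable fun m : ℕ => (m : ℝ) ^ 2 * r ^ m :=
    summable_pow_mul_geometric_of_norm_lt_one 2 (by rwa [Real.norm_of_nonneg hr0])
  have h2 := (h.comp_injective doubling_strictMono.injective).mul_left 400
  rw [← summable_nat_add_iff 3]
  refine ((summable_nat_add_iff 1).2 h2).of_nonneg_of_le (fun k => by positivity) fun k => ?_
  have h3 : (doubling (k + 3) : ℝ) ≤ 5 * doubling (k + 1) := by
    exact_mod_cast doubling_add_two_le (k + 1) (by omega)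
  have h4 : (4 * doubling (k + 3) : ℝ) ^ 2 ≤ 400 * (doubling (k + 1) : ℝ) ^ 2 := by
    have := pow_le_pow_left₀ (by positivity) h3 2
    nlinarith
  have h5 : k + 3 - 2 = k + 1 := by omega
  rw [h5, Function.comp_apply, ← mul_assoc]
  exact mul_le_mul_of_nonneg_right h4 (by positivity)

/-- `g` is approximated on the parameter box by polynomials at a geometric rate. -/
def GeometricApprox (α β : Fin N → ℝ) (g : (Fin N → ℝ) → E) (G ρ : ℝ) : Prop :=
  ∀ K : ℕ, ∃ q : (Fin N → ℝ) → E, (∀ l, PolyIn l K q) ∧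
    ∀ y ∈ paramBox α β, ‖g y - q y‖ ≤ G * ρ ^ K

/-- The surplus annihilates an approximant with `doubling (j l - 1)` coefficients in `y_l`, so only
the approximation error is left. -/
lemma norm_surplus_le_of_approx (hαβ : ∀ n, α n < β n) {g : (Fin N → ℝ) → E} {G ρ : ℝ}
    (hg : GeometricApprox α β g G ρ) (j : MIdx N) (l : Fin N) {y : Fin N → ℝ}
    (hy : y ∈ paramBox α β) :
    ‖surplus α β j g y‖ ≤ surplusBound j * (G * ρ ^ doubling (j l - 1)) := by
  obtain ⟨q, hq, hgq⟩ := hg (doubling (j l - 1))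
  have h := norm_surplus_le hαβ j (v := g - q) hgq hy
  rwa [map_sub, surplus_eq_zero_of_polyIn hαβ (hq l) le_rfl, sub_zero] at h

lemma norm_surplus_le_prod (hαβ : ∀ n, α n < β n) {g : (Fin N → ℝ) → E} {G r : ℝ}
    (hG : 0 ≤ G) (hr0 : 0 ≤ r) (hr1 : r ≤ 1) (hg : GeometricApprox α β g G (r ^ N))
    (j : MIdx N) (l : Fin N) {y : Fin N → ℝ} (hy : y ∈ paramBox α β) :
    ‖surplus α β j g y‖ ≤ surplusBound j * (G * ∏ n, r ^ doubling (j n - 1)) := by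
  -- Decay is available in one direction only. Using the finest one with rate `r ^ N` gives the
  -- exponent `N * max`, which dominates the sum over all directions and yields a product.
  obtain ⟨l', -, hl'⟩ := Finset.exists_max_image Finset.univ (fun n => doubling (j n - 1))
    ⟨l, Finset.mem_univ l⟩
  refine (norm_surplus_le_of_approx hαβ hg j l' hy).trans ?_
  refine mul_le_mul_of_nonneg_left (mul_le_mul_of_nonneg_left ?_ hG) (surplusBound_nonneg j)
  rw [Finset.prod_pow_eq_pow_sum, ← pow_mul]
  refine pow_le_pow_of_le_one hr0 hr1 ?_
  exact (Finset.sum_le_card_nsmul _ _ _ hl').trans (by simp)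

lemma surplusBound_mono {i j : MIdx N} (h : i ≤ j) : surplusBound i ≤ surplusBound j := by
  refine Finset.prod_le_prod (fun n _ => by positivity) fun n _ => ?_
  have : (doubling (i n) : ℝ) ≤ doubling (j n) := by
    exact_mod_cast doubling_strictMono.monotone (h n)
  linarith

/-- The pointwise estimators on the margins are dominated by a summable family. -/
theorem exists_summable_bound (hαβ : ∀ n, α n < β n) {C : ℝ} (hC : 0 ≤ C)
    (hM : ∀ l x, ‖M l x‖ ≤ C * ‖x‖) {g : (Fin N → ℝ) → E} {G ρ : ℝ} (hG : 0 ≤ G) (hρ0 : 0 ≤ ρ)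
    (hρ1 : ρ < 1) (hg : GeometricApprox α β g G ρ) :
    ∃ w : MIdx N → ℝ, Summable w ∧ ∀ I, IsIndexSet I → ∀ i ∈ margin I, ∀ y ∈ paramBox α β,
      ‖surplus α β i (affineMul M₀ M (sparseInterp α β I g)) y‖ ≤ w i := by
  rcases Nat.eq_zero_or_pos N with rfl | hN
  · refine ⟨0, summable_zero, fun I _ i hi => ?_⟩
    obtain ⟨-, j, -, n, -⟩ := mem_margin.1 hi
    exact n.elim0
  obtain ⟨r, hr0, hr1, rfl⟩ : ∃ r : ℝ, 0 ≤ r ∧ r < 1 ∧ r ^ N = ρ :=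
    ⟨ρ ^ ((N : ℝ)⁻¹), by positivity, Real.rpow_lt_one hρ0 hρ1 (by positivity),
      Real.rpow_inv_natCast_pow hρ0 hN.ne'⟩
  obtain ⟨R, hR0, hR⟩ : ∃ R : ℝ, 0 ≤ R ∧ ∀ y ∈ paramBox α β, ∀ l, |y l| ≤ R := by
    refine ⟨∑ l, (|α l| + |β l|), by positivity, fun y hy l => ?_⟩
    refine le_trans ?_ (Finset.single_le_sum (f := fun l => |α l| + |β l|)
      (fun l _ => by positivity) (Finset.mem_univ l))
    exact (abs_le_max_abs_abs (hy.1 l) (hy.2 l)).trans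
      (max_le_add_of_nonneg (abs_nonneg _) (abs_nonneg _))
  -- The square accounts for the two nested surpluses, at `i` and at `i - e_l`. The shift by 2
  -- combines the step to `i - e_l` with the level below, on which the surplus vanishes.
  set f : ℕ → ℝ := fun k => (4 * doubling k : ℝ) ^ 2 * r ^ doubling (k - 2) with hf
  refine ⟨fun i => (N * (C * (R * G))) * ∏ n, f (i n), (summable_pi_prod (fun k => by positivity)
    (summable_doubling_sq_mul_pow hr0 hr1) N).mul_left _, fun I hI i hi y hy => ?_⟩
  have hterm (l : Fin N) : ‖surplus α β i (mulVar l (surplus α β (i - Pi.single l 1) g)) y‖ ≤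
      R * G * ∏ n, f (i n) := by
    have h1 (y : Fin N → ℝ) (hy : y ∈ paramBox α β) :
        ‖mulVar l (surplus α β (i - Pi.single l 1) g) y‖ ≤
          R * (surplusBound i * (G * ∏ n, r ^ doubling (i n - 2))) := by
      rw [mulVar_apply, norm_smul, Real.norm_eq_abs]
      refine mul_le_mul (hR y hy l) ?_ (norm_nonneg _) hR0
      refine (norm_surplus_le_prod hαβ hG hr0 hr1.le hg _ l hy).trans ?_
      refine mul_le_mul (surplusBound_mono tsub_le_self) (mul_le_mul_of_nonneg_left ?_ hG)
        (by positivity) (surplusBound_nonneg i)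
      refine Finset.prod_le_prod (fun n _ => by positivity) fun n _ =>
        pow_le_pow_of_le_one hr0 hr1.le (doubling_strictMono.monotone ?_)
      by_cases hn : n = l
      · subst hn; simp; omega
      · simp [Pi.single_eq_of_ne hn]; omega
    refine (norm_surplus_le hαβ i h1 hy).trans_eq ?_
    simp only [hf, Finset.prod_mul_distrib, Finset.prod_pow, surplusBound]
    ring
  have hf0 : 0 ≤ ∏ n, f (i n) := Finset.prod_nonneg fun n _ => by positivity
  rw [surplus_affineMul_sparseInterp hαβ hI hi, Finset.sum_apply]
  refine (norm_sum_le _ _).trans ((Finset.sum_le_card_nsmul _ _ (C * (R * G * ∏ n, f (i n)))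
    fun l _ => (hM l _).trans (mul_le_mul_of_nonneg_left ?_ hC)).trans_eq ?_)
  · split_ifs
    · exact hterm l
    · simp only [Pi.zero_apply, norm_zero]; positivity
  · simp only [Finset.card_univ, Fintype.card_fin, nsmul_eq_mul]; ring

/-- A bounded solution of a fixed point equation whose contraction depends affinely on the parameter
is approximated by polynomials at a geometric rate. -/
lemma geometricApprox_of_fixedPoint {g : (Fin N → ℝ) → E} {ρ G : ℝ} (hρ0 : 0 ≤ ρ)
    {F : E} (hK : ∀ y ∈ paramBox α β, ∀ x, ‖affineOp M₀ M y x‖ ≤ ρ * ‖x‖)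
    (hg : ∀ y ∈ paramBox α β, g y = affineOp M₀ M y (g y) + F)
    (hG : ∀ y ∈ paramBox α β, ‖g y‖ ≤ G) : GeometricApprox α β g G ρ := by
  intro K
  induction K with
  | zero => exact ⟨0, fun l => PolyIn.zero l 0, fun y hy => by simpa using hG y hy⟩
  | succ K ih =>
    obtain ⟨q, hq, hgq⟩ := ih
    -- One Picard step: it raises the degree in each variable by at most one and contracts the error
    -- by `ρ`.
    refine ⟨affineMul M₀ M q + fun _ => F, fun l => ?_, fun y hy => ?_⟩
    · rw [affineMul_eq]
      refine PolyIn.add (PolyIn.add (((hq l).mono (Nat.le_succ K)).map M₀)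
        (PolyIn.sum _ fun n _ => ((hq l).mulVar n).map (M n))) ?_
      exact (PolyIn.const l F).mono (by omega)
    · have h1 : g y - (affineMul M₀ M q + fun _ : Fin N → ℝ => F : (Fin N → ℝ) → E) y = affineOp M₀ M y (g y - q y) := by
        rw [map_sub]
        conv_lhs => rw [hg y hy]
        simp [affineMul]
      rw [h1, pow_succ]
      refine (hK y hy _).trans ((mul_le_mul_of_nonneg_left (hgq y hy) hρ0).trans_eq (by ring))

end Estimates

/-! ### The affine diffusion problem -/

lemma paramBox_left_mem {N : ℕ} {α β : Fin N → ℝ} (hαβ : ∀ n, α n < β n) : α ∈ paramBox α β :=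
  ⟨le_rfl, fun n => (hαβ n).le⟩

/-- Bounds that hold almost surely hold on the whole product of the supports. -/
lemma coeff_mem_Icc_of_ae {d N : ℕ} {D : Set (Space d)} {Ω : Type*} [MeasurableSpace Ω]
    {P : Measure Ω} {Y : Fin N → Ω → ℝ} (hY_meas : ∀ n, Measurable (Y n))
    (hY_indep : iIndepFun Y P) {α β : Fin N → ℝ}
    (hY_supp : ∀ n, (P.map (Y n)).support = Set.Icc (α n) (β n))
    {a₀ : Space d → ℝ} {a : Fin N → Space d → ℝ} {amin amax : ℝ}
    (h_bound : ∀ᵐ ω ∂P, ∀ x ∈ D,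
      amin ≤ coeff a₀ a (fun n => Y n ω) x ∧ coeff a₀ a (fun n => Y n ω) x ≤ amax)
    {y : Fin N → ℝ} (hy : y ∈ paramBox α β) {x : Space d} (hx : x ∈ D) :
    coeff a₀ a y x ∈ Set.Icc amin amax := by
  by_contra hcon
  have hcont : Continuous fun y => coeff a₀ a y x := by unfold coeff; fun_prop
  -- For fixed `x` a violated bound persists on an open product of neighbourhoods. By independence
  -- its probability is a product of numbers that are positive by the support condition, yet it must
  -- be null.
  obtain ⟨U, hU, hUsub⟩ := isOpen_pi_iff'.1
    ((isClosed_Icc (a := amin) (b := amax)).isOpen_compl.preimage hcont) y hcon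
  have h1 := hY_indep.measure_inter_preimage_eq_mul Finset.univ (sets := U)
    fun n _ => (hU n).1.measurableSet
  have h2 : P (⋂ n ∈ (Finset.univ : Finset (Fin N)), Y n ⁻¹' U n) = 0 := by
    refine measure_mono_null (fun ω hω => ?_) (ae_iff.1 h_bound)
    intro hall
    have hmem : (fun n => Y n ω) ∈ Set.univ.pi U := fun n _ => by
      have := Set.mem_iInter₂.1 hω n (Finset.mem_univ n)
      exact this
    exact hUsub hmem (hall x hx)
  rw [h2, eq_comm, Finset.prod_eq_zero_iff] at h1
  obtain ⟨n, -, hn⟩ := h1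
  have h3 : y n ∈ (P.map (Y n)).support := by
    rw [hY_supp n]
    exact ⟨hy.1 n, hy.2 n⟩
  have h4 := (Measure.mem_support_iff_forall _).1 h3 (U n) ((hU n).1.mem_nhds (hU n).2)
  rw [Measure.map_apply (hY_meas n) (hU n).1.measurableSet, hn] at h4
  exact lt_irrefl _ h4

/-! ### The coefficient as an affine family of multiplication operators -/

section Multiplication

variable {d N : ℕ} {D : Set (Space d)}

/-- Multiplication by a bounded measurable function on `L²` vector fields. -/
lemma exists_mulOp (hD : IsOpen D) {b : Space d → ℝ} (hb : AEMeasurable b (volume.restrict D))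
    {C : ℝ} (hbC : ∀ x ∈ D, |b x| ≤ C) :
    ∃ T : L2Field D →ₗ[ℝ] L2Field D, (∀ v, T v =ᵐ[volume.restrict D] fun x => b x • v x) ∧
      ∀ v, ‖T v‖ ≤ C * ‖v‖ := by
  have hae : ∀ᵐ x ∂volume.restrict D, |b x| ≤ C :=
    (ae_restrict_mem hD.measurableSet).mono hbC
  have hle (v : L2Field D) : ∀ᵐ x ∂volume.restrict D, ‖b x • v x‖ ≤ C * ‖v x‖ := by
    filter_upwards [hae] with x hx
    rw [norm_smul]
    exact mul_le_mul_of_nonneg_right hx (norm_nonneg _)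
  have hmem (v : L2Field D) : MemLp (fun x => b x • v x) 2 (volume.restrict D) :=
    (Lp.memLp v).of_le_mul (hb.aestronglyMeasurable.smul (Lp.aestronglyMeasurable v)) (hle v)
  refine ⟨{ toFun := fun v => (hmem v).toLp, map_add' := fun v w => ?_, map_smul' := fun c v => ?_ },
    fun v => (hmem v).coeFn_toLp, fun v => ?_⟩
  · refine Lp.ext ?_
    filter_upwards [(hmem (v + w)).coeFn_toLp, Lp.coeFn_add (hmem v).toLp (hmem w).toLp,
      (hmem v).coeFn_toLp, (hmem w).coeFn_toLp, Lp.coeFn_add v w] with x h1 h2 h3 h4 h5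
    rw [h1, h2, h5, Pi.add_apply, Pi.add_apply, h3, h4, smul_add]
  · refine Lp.ext ?_
    filter_upwards [(hmem (c • v)).coeFn_toLp, Lp.coeFn_smul c (hmem v).toLp,
      (hmem v).coeFn_toLp, Lp.coeFn_smul c v] with x h1 h2 h3 h4
    rw [h1, RingHom.id_apply, h2, h4, Pi.smul_apply, Pi.smul_apply, h3, smul_comm]
  · refine Lp.norm_le_mul_norm_of_ae_le_mul ?_
    filter_upwards [(hmem v).coeFn_toLp, hle v] with x h1 h2
    simp only [LinearMap.coe_mk, AddHom.coe_mk]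
    rw [h1]
    exact h2

lemma flux_eq {b : Space d → ℝ} {v : H10 D} {F : L2Field D}
    (h : F =ᵐ[volume.restrict D] fun x => b x • grad v x) : flux b v = F := by
  have hm : MemLp (fun x => b x • grad v x) 2 (volume.restrict D) :=
    (memLp_congr_ae h).1 (Lp.memLp F)
  rw [flux, dif_pos hm]
  exact Lp.ext (hm.coeFn_toLp.trans h.symm)

/-- The affine coefficient acts as an affine operator. -/
lemma exists_affineOp_coeff (hD : IsOpen D) {α β : Fin N → ℝ} (hαβ : ∀ n, α n < β n)
    {a₀ : Space d → ℝ} {a : Fin N → Space d → ℝ}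
    (ha₀ : AEMeasurable a₀ (volume.restrict D))
    (ha : ∀ n, AEMeasurable (a n) (volume.restrict D)) {amin amax : ℝ}
    (h : ∀ y ∈ paramBox α β, ∀ x ∈ D, coeff a₀ a y x ∈ Set.Icc amin amax) :
    ∃ (M₀ : L2Field D →ₗ[ℝ] L2Field D) (M : Fin N → L2Field D →ₗ[ℝ] L2Field D) (C : ℝ),
      0 ≤ C ∧ (∀ l v, ‖M l v‖ ≤ C * ‖v‖) ∧
      ∀ y v, affineOp M₀ M y v =ᵐ[volume.restrict D] fun x => coeff a₀ a y x • v x := by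
  -- Each `a l` is a difference quotient of the coefficient between two vertices of the box;
  -- nondegenerate intervals therefore force it to be bounded.
  have hal (l : Fin N) : ∀ x ∈ D, |a l x| ≤ |(amax - amin) / (β l - α l)| := by
    intro x hx
    have h1 := h α (paramBox_left_mem hαβ) x hx
    have hmem : Function.update α l (β l) ∈ paramBox α β := by
      constructor <;> intro n <;> by_cases hn : n = l
      · subst hn; simpa using (hαβ n).le
      · simp [Function.update_of_ne hn]
      · subst hn; simp
      · simpa [Function.update_of_ne hn] using (hαβ n).le
    have h2 := h _ hmem x hx
    have h3 : coeff a₀ a (Function.update α l (β l)) x - coeff a₀ a α x =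
        a l x * (β l - α l) := by
      simp only [coeff, add_sub_add_left_eq_sub, ← Finset.sum_sub_distrib]
      rw [Finset.sum_eq_single l]
      · simp; ring
      · intro n _ hn; simp [Function.update_of_ne hn]
      · simp
    have hpos : 0 < β l - α l := sub_pos.2 (hαβ l)
    have h4 : a l x = (coeff a₀ a (Function.update α l (β l)) x - coeff a₀ a α x) /
        (β l - α l) := by
      rw [h3]; field_simp
    rw [h4, abs_div, abs_div]
    refine div_le_div_of_nonneg_right ?_ (abs_nonneg _)
    rw [abs_le]
    have := le_abs_self (amax - amin)
    constructor <;> linarith [h1.1, h1.2, h2.1, h2.2]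
  have ha₀l : ∀ x ∈ D, |a₀ x| ≤
      (|amin| + |amax|) + ∑ l, |(amax - amin) / (β l - α l)| * |α l| := by
    intro x hx
    have h1 := h α (paramBox_left_mem hαβ) x hx
    have h2 : a₀ x = coeff a₀ a α x - ∑ l, a l x * α l := by simp [coeff]
    rw [h2]
    refine (abs_sub _ _).trans (add_le_add ?_ ?_)
    · exact (abs_le_max_abs_abs h1.1 h1.2).trans
        (max_le_add_of_nonneg (abs_nonneg _) (abs_nonneg _))
    · refine (Finset.abs_sum_le_sum_abs _ _).trans (Finset.sum_le_sum fun l _ => ?_)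
      rw [abs_mul]
      exact mul_le_mul_of_nonneg_right (hal l x hx) (abs_nonneg _)
  obtain ⟨M₀, hM₀, -⟩ := exists_mulOp hD ha₀ ha₀l
  choose M hM hMC using fun l => exists_mulOp hD (ha l) (hal l)
  refine ⟨M₀, M, ∑ l, |(amax - amin) / (β l - α l)|, by positivity, fun l v => ?_, fun y v => ?_⟩
  · refine (hMC l v).trans (mul_le_mul_of_nonneg_right ?_ (norm_nonneg _))
    exact Finset.single_le_sum (f := fun l => |(amax - amin) / (β l - α l)|)
      (fun _ _ => abs_nonneg _) (Finset.mem_univ l)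
  · have hsum : (⇑(∑ l, y l • M l v) : Space d → Space d) =ᵐ[volume.restrict D]
        fun x => ∑ l, (y l * a l x) • v x := by
      refine (Lp.coeFn_finsetSum Finset.univ fun l => y l • M l v).trans ?_
      have : ∀ᵐ x ∂volume.restrict D, ∀ l, (y l • M l v : L2Field D) x = (y l * a l x) • v x := by
        refine ae_all_iff.2 fun l => ?_
        filter_upwards [Lp.coeFn_smul (y l) (M l v), hM l v] with x h1 h2
        rw [h1, Pi.smul_apply, h2, smul_smul]
      filter_upwards [this] with x hx
      rw [Finset.sum_apply]
      exact Finset.sum_congr rfl fun l _ => hx l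
    have heq : affineOp M₀ M y v = M₀ v + ∑ l, y l • M l v := by simp [affineOp]
    rw [heq]
    filter_upwards [Lp.coeFn_add (M₀ v) (∑ l, y l • M l v), hM₀ v, hsum] with x h1 h2 h3
    rw [h1, Pi.add_apply, h2, h3, ← Finset.sum_smul, ← add_smul, coeff]
    congr 2
    exact Finset.sum_congr rfl fun l _ => mul_comm _ _

/-- The gradient as a linear map. -/
def gradLM (D : Set (Space d)) : H10 D →ₗ[ℝ] L2Field D :=
  (LinearMap.snd ℝ (L2 D) (L2Field D)).comp (H10 D).subtype

lemma gradLM_apply (v : H10 D) : gradLM D v = grad v := rfl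

lemma IsWeakSolution.inner_eq {b : Space d → ℝ} {f : L2 D} {v : H10 D} (h : IsWeakSolution b f v)
    {F : L2Field D} (hF : F =ᵐ[volume.restrict D] fun x => b x • grad v x) (w : H10 D) :
    inner ℝ F (grad w) = ∫ x in D, f x * val w x := by
  rw [← h w, L2.inner_def]
  refine integral_congr_ae ?_
  filter_upwards [hF] with x hx
  rw [hx, real_inner_smul_left]

end Multiplication

/-! ### Abstract elliptic problems in a Hilbert space -/

section Elliptic

variable {N : ℕ} {E : Type*} [NormedAddCommGroup E] [InnerProductSpace ℝ E] {α β : Fin N → ℝ}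
  {M₀ : E →ₗ[ℝ] E} {M : Fin N → E →ₗ[ℝ] E}

lemma inner_ge_of_contraction {A : E →ₗ[ℝ] E} {ω ρ : ℝ} (hω : 0 < ω)
    (h : ∀ x, ‖x - ω⁻¹ • A x‖ ≤ ρ * ‖x‖) (x : E) :
    ω * (1 - ρ) * ‖x‖ ^ 2 ≤ inner ℝ (A x) x := by
  have h1 : inner ℝ (A x) x = ω * (‖x‖ ^ 2 - inner ℝ (x - ω⁻¹ • A x) x) := by
    rw [inner_sub_left, real_inner_self_eq_norm_sq, real_inner_smul_left]
    field_simp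
    ring
  have h2 : inner ℝ (x - ω⁻¹ • A x) x ≤ ρ * ‖x‖ ^ 2 := by
    refine (real_inner_le_norm _ _).trans ?_
    nlinarith [mul_le_mul_of_nonneg_right (h x) (norm_nonneg x)]
  rw [h1, mul_assoc]
  refine mul_le_mul_of_nonneg_left ?_ hω.le
  linarith

/-- Solutions of affine elliptic variational problems are approximated by polynomials in the
parameters at a geometric rate. -/
lemma exists_geometricApprox [CompleteSpace E] (V : Submodule ℝ E)
    {ω ρ : ℝ} (hρ0 : 0 ≤ ρ) (hρ1 : ρ < 1)
    (h : ∀ y ∈ paramBox α β, ∀ x, ‖x - ω⁻¹ • affineOp M₀ M y x‖ ≤ ρ * ‖x‖)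
    {g : (Fin N → ℝ) → E} (hgV : ∀ y, g y ∈ V)
    (hg : ∀ y ∈ paramBox α β, ∀ w ∈ V,
      inner ℝ (affineOp M₀ M y (g y)) w = inner ℝ (affineOp M₀ M α (g α)) w) :
    ∃ G, 0 ≤ G ∧ GeometricApprox α β g G ρ := by
  -- The projection needs a complete subspace. Passing to the closure avoids having to show that
  -- gradients form a closed subspace, so no Poincaré inequality enters.
  set H := V.topologicalClosure with hH
  set Q : E →ₗ[ℝ] E := (H.starProjection : E →L[ℝ] E).toLinearMap with hQ
  have hQle (x : E) : ‖Q x‖ ≤ ‖x‖ := H.norm_starProjection_apply_le x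
  have hQg (y : Fin N → ℝ) : Q (g y) = g y :=
    Submodule.starProjection_eq_self_iff.2 (V.le_topologicalClosure (hgV y))
  set F : E := ω⁻¹ • Q (affineOp M₀ M α (g α)) with hF
  -- The weak form says that the projected flux does not depend on `y`. This makes the inhomogeneity
  -- `F` of the Richardson fixed point equation constant.
  have hQA (y : Fin N → ℝ) (hy : y ∈ paramBox α β) :
      Q (affineOp M₀ M y (g y)) = Q (affineOp M₀ M α (g α)) := by
    rw [← sub_eq_zero, ← map_sub]
    refine (Submodule.starProjection_apply_eq_zero_iff _).2 ?_
    rw [hH, Submodule.orthogonal_closure]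
    refine (Submodule.mem_orthogonal' _ _).2 fun w hw => ?_
    rw [inner_sub_left, hg y hy w hw, sub_self]
  set K₀ : E →ₗ[ℝ] E := Q ∘ₗ (LinearMap.id - ω⁻¹ • M₀) with hK₀
  set K : Fin N → E →ₗ[ℝ] E := fun l => -(ω⁻¹ • Q ∘ₗ M l) with hK
  have hKop (y : Fin N → ℝ) (x : E) :
      affineOp K₀ K y x = Q (x - ω⁻¹ • affineOp M₀ M y x) := by
    simp only [affineOp, hK₀, hK, LinearMap.add_apply, LinearMap.sum_apply, LinearMap.smul_apply,
      LinearMap.neg_apply, LinearMap.comp_apply, LinearMap.sub_apply, LinearMap.id_apply, map_sub,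
      map_smul, map_add, map_sum, smul_add, Finset.smul_sum, smul_neg, Finset.sum_neg_distrib]
    rw [Finset.sum_congr rfl fun l _ => smul_comm (y l) ω⁻¹ (Q (M l x))]
    abel
  have hcontr (y : Fin N → ℝ) (hy : y ∈ paramBox α β) (x : E) :
      ‖affineOp K₀ K y x‖ ≤ ρ * ‖x‖ := by
    rw [hKop]
    exact (hQle _).trans (h y hy x)
  have hfix (y : Fin N → ℝ) (hy : y ∈ paramBox α β) : g y = affineOp K₀ K y (g y) + F := by
    rw [hKop, map_sub, map_smul, hQg, hQA y hy]
    simp [hF]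
  refine ⟨‖F‖ / (1 - ρ), div_nonneg (norm_nonneg _) (by linarith),
    geometricApprox_of_fixedPoint hρ0 hcontr hfix fun y hy => ?_⟩
  rw [le_div_iff₀ (by linarith)]
  have h1 : ‖g y‖ ≤ ρ * ‖g y‖ + ‖F‖ := by
    conv_lhs => rw [hfix y hy]
    exact (norm_add_le _ _).trans (by gcongr; exact hcontr y hy _)
  linarith

/-- Reliability of the estimator. -/
lemma norm_sub_sparseInterp_le (hαβ : ∀ n, α n < β n) {I : Finset (MIdx N)} (hI : IsIndexSet I)
    {g : (Fin N → ℝ) → E} {κ : ℝ} (hκ : 0 < κ) {y : Fin N → ℝ} (hy : y ∈ paramBox α β)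
    (hcoer : ∀ x, κ * ‖x‖ ^ 2 ≤ inner ℝ (affineOp M₀ M y x) x)
    (hg : ∀ z ∈ paramBox α β, inner ℝ (affineOp M₀ M z (g z)) (g y - sparseInterp α β I g y) =
      inner ℝ (affineOp M₀ M y (g y)) (g y - sparseInterp α β I g y)) :
    ‖g y - sparseInterp α β I g y‖ ≤ κ⁻¹ *
      ‖∑ i ∈ margin I, surplus α β i (affineMul M₀ M (sparseInterp α β I g)) y‖ := by
  set e := g y - sparseInterp α β I g y with he
  set S := ∑ i ∈ margin I, surplus α β i (affineMul M₀ M (sparseInterp α β I g)) y with hS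
  -- The test functional pairs with the error at the fixed `y`, while the identity for the exact
  -- flux is used at all parameters `z`.
  have h1 := residual_eq_sum_margin (M₀ := M₀) (M := M) hαβ hI (g := g)
    (innerSL ℝ e).toLinearMap (c := inner ℝ e (affineOp M₀ M y (g y)))
    (fun z hz => by
      rw [real_inner_comm, ← hg z hz, real_inner_comm]
      rfl) hy
  have h2 : inner ℝ e (affineOp M₀ M y (sparseInterp α β I g y)) -
      inner ℝ e (affineOp M₀ M y (g y)) = inner ℝ e S := h1
  have h3 : inner ℝ (affineOp M₀ M y e) e = -inner ℝ e S := by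
    rw [← h2, he, map_sub, real_inner_comm, inner_sub_right]
    ring
  have h4 : κ * ‖e‖ ^ 2 ≤ ‖e‖ * ‖S‖ := by
    refine (hcoer e).trans ?_
    rw [h3, ← inner_neg_right, ← norm_neg S]
    exact real_inner_le_norm _ _
  rw [le_inv_mul_iff₀ hκ]
  rcases (norm_nonneg e).eq_or_lt with h0 | h0
  · rw [← h0, mul_zero]
    exact norm_nonneg _
  · refine le_of_mul_le_mul_left ?_ h0
    linarith [sq ‖e‖, h4]

end Elliptic

/-! ### Convergence -/

section Convergence

variable {d N : ℕ} {D : Set (Space d)} {α β : Fin N → ℝ}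

/-- Scaling by the midpoint of `[amin, amax]` puts `1 - b/ω` pointwise within `(amax - amin)/(amin +
amax)` of zero. -/
lemma norm_sub_inv_smul_le (hD : IsOpen D) {b : Space d → ℝ} {amin amax : ℝ} (hamin : 0 < amin)
    (hle : amin ≤ amax) (hb : ∀ x ∈ D, b x ∈ Set.Icc amin amax) {v F : L2Field D}
    (hF : F =ᵐ[volume.restrict D] fun x => b x • v x) :
    ‖v - ((amin + amax) / 2)⁻¹ • F‖ ≤ (amax - amin) / (amin + amax) * ‖v‖ := by
  refine Lp.norm_le_mul_norm_of_ae_le_mul ?_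
  filter_upwards [hF, Lp.coeFn_sub v (((amin + amax) / 2)⁻¹ • F),
    Lp.coeFn_smul ((amin + amax) / 2)⁻¹ F, ae_restrict_mem hD.measurableSet] with x h1 h2 h3 hx
  have hpos : 0 < amin + amax := by linarith
  have h4 : v x - ((amin + amax) / 2)⁻¹ • b x • v x =
      ((amin + amax - 2 * b x) / (amin + amax)) • v x := by
    rw [smul_smul]
    nth_rw 1 [← one_smul ℝ (v x)]
    rw [← sub_smul]
    congr 1
    field_simp
  rw [h2, Pi.sub_apply, h3, Pi.smul_apply, h1, h4, norm_smul, Real.norm_eq_abs, abs_div,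
    abs_of_pos hpos]
  refine mul_le_mul_of_nonneg_right (div_le_div_of_nonneg_right ?_ hpos.le) (norm_nonneg _)
  rw [abs_le]
  constructor <;> linarith [(hb x hx).1, (hb x hx).2]

lemma normLinftyL2_le {F : (Fin N → ℝ) → L2Field D} {C : ℝ}
    (h : ∀ y ∈ paramBox α β, ‖F y‖ ≤ C) : normLinftyL2 α β F ≤ ENNReal.ofReal C := by
  rw [normLinftyL2, eLpNorm_exponent_top]
  exact eLpNormEssSup_le_of_ae_bound ((ae_restrict_mem measurableSet_Icc).mono h)

/-- The convergence theorem in terms of bounds on the coefficient over the parameter box. -/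
theorem tendsto_estimator_and_error (hD : IsOpen D) (f : L2 D) (hαβ : ∀ n, α n < β n)
    {a₀ : Space d → ℝ} {a : Fin N → Space d → ℝ}
    (ha₀ : AEMeasurable a₀ (volume.restrict D))
    (ha : ∀ n, AEMeasurable (a n) (volume.restrict D)) {amin amax : ℝ} (hamin : 0 < amin)
    (hle : amin ≤ amax)
    (hbound : ∀ y ∈ paramBox α β, ∀ x ∈ D, coeff a₀ a y x ∈ Set.Icc amin amax)
    (u : (Fin N → ℝ) → H10 D)
    (hu : ∀ y ∈ paramBox α β, IsWeakSolution (coeff a₀ a y) f (u y)) (kind : ProfitKind) :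
    Tendsto (fun ℓ => paramEstimator a₀ a α β u (algorithmSets kind a₀ a α β u ℓ))
        atTop (𝓝 0) ∧
      Tendsto (fun ℓ => normLinftyV α β
          (fun y => u y - sparseInterp α β (algorithmSets kind a₀ a α β u ℓ) u y))
        atTop (𝓝 0) := by
  obtain ⟨M₀, M, C, hC, hMC, hM⟩ := exists_affineOp_coeff hD hαβ ha₀ ha hbound
  set g : (Fin N → ℝ) → L2Field D := fun y => grad (u y) with hg
  have hgrad (I : Finset (MIdx N)) (y : Fin N → ℝ) :
      grad (sparseInterp α β I u y) = sparseInterp α β I g y :=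
    (congrFun (sparseInterp_map (gradLM D) I u) y).symm
  have hpoint (I : Finset (MIdx N)) (i : MIdx N) : pointEstimator a₀ a α β u I i =
      normLinftyL2 α β (surplus α β i (affineMul M₀ M (sparseInterp α β I g))) := by
    rw [pointEstimator]
    congr 2
    funext y
    rw [affineMul, ← hgrad]
    exact flux_eq (hM y _)
  have hweak (y : Fin N → ℝ) (hy : y ∈ paramBox α β) (w : H10 D) :
      inner ℝ (affineOp M₀ M y (g y)) (grad w) = ∫ x in D, f x * val w x :=
    (hu y hy).inner_eq (hM y _) w
  have hpos : 0 < amin + amax := by linarith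
  have hρ0 : 0 ≤ (amax - amin) / (amin + amax) := div_nonneg (by linarith) hpos.le
  have hρ1 : (amax - amin) / (amin + amax) < 1 := by
    rw [div_lt_one hpos]; linarith
  have hcontr (y : Fin N → ℝ) (hy : y ∈ paramBox α β) (v : L2Field D) :
      ‖v - ((amin + amax) / 2)⁻¹ • affineOp M₀ M y v‖ ≤ (amax - amin) / (amin + amax) * ‖v‖ :=
    norm_sub_inv_smul_le hD hamin hle (hbound y hy) (hM y v)
  obtain ⟨G, hG, happrox⟩ := exists_geometricApprox (LinearMap.range (gradLM D)) hρ0 hρ1 hcontr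
    (g := g) (fun y => ⟨u y, rfl⟩) (by
      rintro y hy _ ⟨w, rfl⟩
      rw [gradLM_apply, hweak y hy w, hweak α (paramBox_left_mem hαβ) w])
  obtain ⟨w, hw, hwb⟩ := exists_summable_bound (M₀ := M₀) hαβ hC hMC hG hρ0 hρ1 happrox
  have hest : Tendsto (fun ℓ => paramEstimator a₀ a α β u (algorithmSets kind a₀ a α β u ℓ))
      atTop (𝓝 0) := by
    refine tendsto_sum_margin_enrich kind (pointEstimator a₀ a α β u)
      (fun i => ENNReal.ofReal (w i)) hw.tsum_ofReal_ne_top fun I hI i hi => ?_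
    rw [hpoint]
    exact normLinftyL2_le (hwb I hI i hi)
  refine ⟨hest, ?_⟩
  -- This is the coercivity constant `amin`, in the form delivered by `inner_ge_of_contraction`.
  set κ : ℝ := (amin + amax) / 2 * (1 - (amax - amin) / (amin + amax)) with hκ
  have hκ0 : 0 < κ := mul_pos (by linarith) (by linarith)
  refine tendsto_of_tendsto_of_tendsto_of_le_of_le tendsto_const_nhds
    (h := fun ℓ => ENNReal.ofReal κ⁻¹ *
      paramEstimator a₀ a α β u (algorithmSets kind a₀ a α β u ℓ)) ?_ (fun _ => zero_le)
    fun ℓ => ?_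
  · simpa only [mul_zero] using ENNReal.Tendsto.const_mul hest (Or.inr ENNReal.ofReal_ne_top)
  · set I := algorithmSets kind a₀ a α β u ℓ with hI
    have hIv : IsIndexSet I := isIndexSet_enrich kind _ ℓ
    have hpt (i : MIdx N) : ∀ᵐ y ∂volume.restrict (paramBox α β),
        ‖surplus α β i (affineMul M₀ M (sparseInterp α β I g)) y‖ₑ ≤
          pointEstimator a₀ a α β u I i := by
      rw [hpoint, normLinftyL2, eLpNorm_exponent_top]
      exact ae_le_essSup
    have hall : ∀ᵐ y ∂volume.restrict (paramBox α β), ∀ i ∈ margin I,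
        ‖surplus α β i (affineMul M₀ M (sparseInterp α β I g)) y‖ₑ ≤
          pointEstimator a₀ a α β u I i :=
      (ae_ball_iff (margin I).countable_toSet).2 fun i _ => hpt i
    show eLpNorm _ ∞ _ ≤ _
    rw [eLpNorm_exponent_top]
    refine essSup_le_of_ae_le _ ?_
    filter_upwards [hall, ae_restrict_mem measurableSet_Icc] with y hy hyb
    have he : grad (u y - sparseInterp α β I u y) = g y - sparseInterp α β I g y := by
      rw [← hgrad]
      rfl
    have h1 := norm_sub_sparseInterp_le (M₀ := M₀) (M := M) hαβ hIv (g := g) hκ0 hyb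
      (inner_ge_of_contraction (by linarith) (hcontr y hyb)) (fun z hz => by
        rw [← he, hweak z hz, hweak y hyb])
    rw [he, ← ofReal_norm]
    refine (ENNReal.ofReal_le_ofReal h1).trans ?_
    rw [ENNReal.ofReal_mul (inv_nonneg.2 hκ0.le), ofReal_norm]
    gcongr
    exact (enorm_sum_le _ _).trans (Finset.sum_le_sum hy)

end Convergence

end SparseGrid

end

open SparseGrid
theorem mainTheorem3 {d N : ℕ} {D : Set (Space d)} (hD : IsOpen D) (f : L2 D)
    {Ω : Type*} [MeasurableSpace Ω] (P : Measure Ω) [IsProbabilityMeasure P]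
    (Y : Fin N → Ω → ℝ) (hY_meas : ∀ n, Measurable (Y n)) (hY_indep : iIndepFun Y P)
    (α β : Fin N → ℝ) (hαβ : ∀ n, α n < β n)
    (hY_supp : ∀ n, (P.map (Y n)).support = Set.Icc (α n) (β n))
    (a₀ : Space d → ℝ) (a : Fin N → Space d → ℝ)
    (ha₀ : AEMeasurable a₀ (volume.restrict D))
    (ha : ∀ n, AEMeasurable (a n) (volume.restrict D))
    (amin amax : ℝ) (hamin : 0 < amin)
    (h_bound : ∀ᵐ ω ∂P, ∀ x ∈ D,
      amin ≤ coeff a₀ a (fun n => Y n ω) x ∧ coeff a₀ a (fun n => Y n ω) x ≤ amax)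
    (u : (Fin N → ℝ) → H10 D)
    (hu : ∀ y ∈ paramBox α β, IsWeakSolution (coeff a₀ a y) f (u y))
    (kind : ProfitKind) :
    Tendsto (fun ℓ => paramEstimator a₀ a α β u (algorithmSets kind a₀ a α β u ℓ))
        atTop (𝓝 0) ∧
      Tendsto (fun ℓ => normLinftyV α β
          (fun y => u y - sparseInterp α β (algorithmSets kind a₀ a α β u ℓ) u y))
        atTop (𝓝 0) := by
  -- For empty `D` the bounds do not imply `amin ≤ amax`, so the upper bound is enlarged to `max
  -- amax amin`.
  refine tendsto_estimator_and_error hD f hαβ ha₀ ha hamin (le_max_right amax amin)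
    (fun y hy x hx => ?_) u hu kind
  have h := coeff_mem_Icc_of_ae hY_meas hY_indep hY_supp h_bound hy hx
  exact ⟨h.1, h.2.trans (le_max_left _ _)⟩
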